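/- Let $\mathcal G=(\mathcal V,\mathcal E,|\cdot|)$ be a metric graph: $(\mathcal V,\mathcal E)$ is a countably infinite, connected, locally finite, simple graph, and every edge $e$ has a length $|e|\in(0,\infty)$ and is identified with the interval $[0,|e|]$; the intervals are glued together at the vertices. A topological end $\gamma$ of $\mathcal G$ is an equivalence class of sequences $(U_n)_{n\ge 0}$ of non-empty open connected subsets of $\mathcal G$ with compact boundaries such that $U_{n+1}\subseteq U_n$ for all $n$ and $\bigcap_n\overline{U_n}=\emptyset$, where $(U_n)$ and $(U_n')$ are equivalent if every $U_n$ contains some $U_j'$ and every $U_n'$ contains some $U_k$. A ray is a sequence of distinct vertices $(v_n)_{n\ge0}$ with $v_n$ adjacent to $v_{n+1}$ for all $n$; two rays are equivalent if a third ray contains infinitely many vertices of both, and a graph end is an equivalence class of rays. To every topological end $\gamma$ corresponds the unique graph end $\omega_\gamma$ such that, for every sequence $(U_n)$ representing $\gamma$, each $U_n$ contains a ray from $\omega_\gamma$ (viewed as the union of its edges). Let $L^2(\mathcal G)=\bigoplus_{e}L^2(e)$, let $H^1(\mathcal G)$ be the space of continuous $f:\mathcal G\to\mathbb C$ in $L^2(\mathcal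 G)$ with $f|_e\in H^1(e)$ for all $e\in\mathcal E$ and $\sum_{e}\|f'\|_{L^2(e)}^2<\infty$, and let $\mathbf H$ be the maximal Kirchhoff Laplacian: it acts as $f\mapsto -f''$ on every edge, and $\operatorname{dom}(\mathbf H)$ consists of the $f\in L^2(\mathcal G)$ with $f|_e\in H^2(e)$ for all $e\in\mathcal E$ and $f''\in L^2(\mathcal G)$ that are continuous at every vertex $v$ and satisfy $\sum_{e\ni v}f_e'(v)=0$ there, where $f_e'(v)$ is the derivative at $v$ along $e$ in the direction away from $v$. For $f\in H^1(\mathcal G)$ and an end $\gamma$, the value $f(\gamma)$ is the limit $\lim_{n\to\infty}f(v_n)$ along any ray $(v_n)\in\omega_\gamma$. An end $\gamma$ is called nontrivial if $f(\gamma)\ne0$ for some $f\in H^1(\mathcal G)$. It has finite volume if there is a sequence $(U_n)$ representing $\gamma$ such that the Lebesgue measure $\operatorname{vol}(U_n)$ is finite for some $n$. **Theorem.** A topological end $\gamma$ of $\mathcal G$ is nontrivial if and only if it has finite volume. Moreover, for any finite collection $\gamma_1,\dots,\gamma_N$ ($N\ge1$) of distinct nontrivial ends there exists $f\in H^1(\mathcal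 G)\cap\operatorname{dom}(\mathbf H)$ such that $f(\gamma_1)=1$ and $f(\gamma_2)=\dots=f(\gamma_N)=0$. -/

import Mathlib

open MeasureTheory Set Filter Topology

/-- A metric graph: an infinite, connected, locally finite, simple combinatorial graph on the vertex
set `V`, together with a length in `(0, ∞)` for every edge. -/
structure MetricGraph (V : Type*) where
  graph : SimpleGraph V
  countable : Countable V
  infinite : Infinite V
  locallyFinite : ∀ v, (graph.neighborSet v).Finite
  connected : graph.Connected
  len : graph.edgeSet → ℝ
  len_pos : ∀ e, 0 < len e

namespace MetricGraph

variable {V : Type*} (𝒢 : MetricGraph V)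

/-! ### The metric graph as a topological space -/

/-- The edges. -/
abbrev Edge : Type _ := 𝒢.graph.edgeSet

/-- Every edge is given a direction: its initial vertex. -/
noncomputable def src (e : 𝒢.Edge) : V := (Quot.out (e : Sym2 V)).1

/-- Every edge is given a direction: its terminal vertex. -/
noncomputable def tgt (e : 𝒢.Edge) : V := (Quot.out (e : Sym2 V)).2

/-- The disjoint union of the vertex set and of the intervals `[0, |e|]`, before gluing. -/
abbrev PrePoint : Type _ := V ⊕ (Σ e : 𝒢.Edge, Icc (0 : ℝ) (𝒢.len e))

/-- `𝒢.IsAt p v`: the point `p` of the disjoint union is to be glued to the vertex `v`. -/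
def IsAt : 𝒢.PrePoint → V → Prop
  | Sum.inl w, v => w = v
  | Sum.inr ⟨e, t⟩, v =>
      ((t : ℝ) = 0 ∧ 𝒢.src e = v) ∨ ((t : ℝ) = 𝒢.len e ∧ 𝒢.tgt e = v)

theorem IsAt.unique {p : 𝒢.PrePoint} {v w : V} (hv : 𝒢.IsAt p v) (hw : 𝒢.IsAt p w) : v = w := by
  rcases p with u | ⟨e, t⟩
  · exact hv.symm.trans hw
  · have := 𝒢.len_pos e
    rcases hv with ⟨h1, h2⟩ | ⟨h1, h2⟩ <;> rcases hw with ⟨h3, h4⟩ | ⟨h3, h4⟩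
    · exact h2.symm.trans h4
    · linarith
    · linarith
    · exact h2.symm.trans h4

/-- The gluing relation: two points are identified if they are equal or if they are both located at
the same vertex. -/
def glue : Setoid 𝒢.PrePoint where
  r p q := p = q ∨ ∃ v, 𝒢.IsAt p v ∧ 𝒢.IsAt q v
  iseqv :=
    { refl := fun _ => Or.inl rfl
      symm := by
        rintro p q (h | ⟨v, h1, h2⟩)
        · exact Or.inl h.symm
        · exact Or.inr ⟨v, h2, h1⟩
      trans := by
        rintro p q r (rfl | ⟨v, h1, h2⟩) (rfl | ⟨w, h3, h4⟩)
        · exact Or.inl rfl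
        · exact Or.inr ⟨w, h3, h4⟩
        · exact Or.inr ⟨v, h1, h2⟩
        · obtain rfl := IsAt.unique 𝒢 h2 h3
          exact Or.inr ⟨v, h1, h4⟩ }

/-- The points of the metric graph: the intervals `[0, |e|]` glued together at the vertices. -/
def Point : Type _ := Quotient 𝒢.glue

/-- The point given by a vertex. -/
def vertex (v : V) : 𝒢.Point := Quotient.mk 𝒢.glue (Sum.inl v)

/-- The map `[0, |e|] → 𝒢` that identifies the interval with the (closed) edge `e`. -/
def edgeMap (e : 𝒢.Edge) (t : Icc (0 : ℝ) (𝒢.len e)) : 𝒢.Point :=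
  Quotient.mk 𝒢.glue (Sum.inr ⟨e, t⟩)

/-- The natural topology, i.e. the quotient topology: a set is open iff its preimage in each of the
intervals `[0, |e|]` is open. -/
instance : TopologicalSpace 𝒢.Point :=
  ⨆ e : 𝒢.Edge, TopologicalSpace.coinduced (𝒢.edgeMap e) inferInstance

/-- The point with coordinate `t ∈ [0, |e|]` on the edge `e` (real numbers outside `[0, |e|]` are
first projected to this interval). -/
noncomputable def pt (e : 𝒢.Edge) (t : ℝ) : 𝒢.Point :=
  𝒢.edgeMap e (projIcc 0 (𝒢.len e) (𝒢.len_pos e).le t)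

/-- The Lebesgue measure of a subset `A` of the metric graph. -/
noncomputable def vol (A : Set 𝒢.Point) : ENNReal :=
  ∑' e : 𝒢.Edge, volume {t : ℝ | t ∈ Icc 0 (𝒢.len e) ∧ 𝒢.pt e t ∈ A}

/-! ### Rays, graph ends and topological ends -/

/-- A ray: a sequence of distinct vertices in which consecutive vertices are adjacent. -/
structure Ray where
  vtx : ℕ → V
  injective : Function.Injective vtx
  adj : ∀ n, 𝒢.graph.Adj (vtx n) (vtx (n + 1))

variable {𝒢} in
/-- Two rays are equivalent if a third ray contains infinitely many vertices of both. -/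
def Ray.Equiv (R₁ R₂ : 𝒢.Ray) : Prop :=
  ∃ R₃ : 𝒢.Ray, (range R₁.vtx ∩ range R₃.vtx).Infinite ∧ (range R₂.vtx ∩ range R₃.vtx).Infinite

variable {𝒢} in
/-- The subset of the metric graph given by a ray: the union of all (closed) edges of the ray. -/
def Ray.carrier (R : 𝒢.Ray) : Set 𝒢.Point :=
  ⋃ n : ℕ, range (𝒢.edgeMap ⟨s(R.vtx n, R.vtx (n + 1)), R.adj n⟩)

/-- A graph end: an equivalence class of rays. -/
def GraphEnd : Type _ := {ω : Set 𝒢.Ray // ∃ R : 𝒢.Ray, ω = {R' | R.Equiv R'}}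

/-- Decreasing sequences of non-empty connected open sets with compact boundaries such that the
intersection of the closures is empty. -/
structure EndSeq where
  U : ℕ → Set 𝒢.Point
  isOpen : ∀ n, IsOpen (U n)
  isConnected : ∀ n, IsConnected (U n)
  isCompact_frontier : ∀ n, IsCompact (frontier (U n))
  subset : ∀ n, U (n + 1) ⊆ U n
  iInter_closure : ⋂ n, closure (U n) = ∅

/-- Two such sequences are equivalent if each set of either one contains a set of the other. -/
def endSetoid : Setoid 𝒢.EndSeq where
  r A B := ∀ n, (∃ j, B.U j ⊆ A.U n) ∧ ∃ k, A.U k ⊆ B.U n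
  iseqv :=
    { refl := fun _ n => ⟨⟨n, subset_rfl⟩, ⟨n, subset_rfl⟩⟩
      symm := fun h n => ⟨(h n).2, (h n).1⟩
      trans := by
        intro A B C h1 h2 n
        obtain ⟨j, hj⟩ := (h1 n).1
        obtain ⟨i, hi⟩ := (h2 j).1
        obtain ⟨k, hk⟩ := (h2 n).2
        obtain ⟨l, hl⟩ := (h1 k).2
        exact ⟨⟨i, hi.trans hj⟩, ⟨l, hl.trans hk⟩⟩ }

/-- The topological ends of the metric graph. -/
def TopEnd : Type _ := Quotient 𝒢.endSetoid

variable {𝒢}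

/-- The sequence `S` represents the topological end `γ`. -/
def EndSeq.Represents (S : 𝒢.EndSeq) (γ : 𝒢.TopEnd) : Prop := Quotient.mk 𝒢.endSetoid S = γ

/-- The condition on a graph end `ω` that characterizes the graph end `ω_γ` corresponding to the
topological end `γ`: for every sequence `(U_n)` representing `γ`, each `U_n` contains a ray
from `ω`. -/
def TopEnd.Corresponds (γ : 𝒢.TopEnd) (ω : 𝒢.GraphEnd) : Prop :=
  ∀ S : 𝒢.EndSeq, S.Represents γ → ∀ n, ∃ R ∈ ω.1, R.carrier ⊆ S.U n

/-- `HasEndValue f γ z`: the value `f(γ)` exists and is equal to `z`. Namely, there is exactly one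
graph end `ω_γ` corresponding to `γ`, and `f(v_n) → z` along every ray `(v_n)` belonging to it. -/
def HasEndValue (f : 𝒢.Point → ℂ) (γ : 𝒢.TopEnd) (z : ℂ) : Prop :=
  ∃ ω : 𝒢.GraphEnd, (∀ ω' : 𝒢.GraphEnd, γ.Corresponds ω' ↔ ω' = ω) ∧
    ∀ R ∈ ω.1, Tendsto (fun n => f (𝒢.vertex (R.vtx n))) atTop (𝓝 z)

/-- The end `γ` has finite volume: some representing sequence has a member of finite volume. -/
def TopEnd.HasFiniteVolume (γ : 𝒢.TopEnd) : Prop :=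
  ∃ S : 𝒢.EndSeq, S.Represents γ ∧ ∃ n, 𝒢.vol (S.U n) < ⊤

/-! ### Function spaces -/

/-- `f ∈ H¹([0, l])`: `f` is absolutely continuous with square-integrable derivative. -/
def MemSobolev1 (l : ℝ) (f : ℝ → ℂ) : Prop :=
  AbsolutelyContinuousOnInterval f 0 l ∧
    MemLp (derivWithin f (Icc 0 l)) 2 (volume.restrict (Icc 0 l))

/-- `f ∈ H²([0, l])`: `f` and `f'` belong to `H¹([0, l])`. -/
def MemSobolev2 (l : ℝ) (f : ℝ → ℂ) : Prop :=
  MemSobolev1 l f ∧ MemSobolev1 l (derivWithin f (Icc 0 l))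

variable (𝒢) in
/-- The space `L²(𝒢) = ⨁ L²(e)`: families `(F_e)` with `F_e ∈ L²(0, |e|)` and
`∑ ‖F_e‖² < ∞`. -/
def MemL2 (F : 𝒢.Edge → ℝ → ℂ) : Prop :=
  (∀ e, MemLp (F e) 2 (volume.restrict (Icc 0 (𝒢.len e)))) ∧
    ∑' e, eLpNorm (F e) 2 (volume.restrict (Icc 0 (𝒢.len e))) ^ 2 < ⊤

/-- The function `f_e` that `f` induces on the edge `e`, in the coordinate `t ∈ [0, |e|]`. -/
noncomputable def onEdge (f : 𝒢.Point → ℂ) (e : 𝒢.Edge) : ℝ → ℂ := fun t => f (𝒢.pt e t)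

/-- The derivative `f_e'` on the edge `e`, one-sided at the two endpoints. -/
noncomputable def dEdge (f : 𝒢.Point → ℂ) (e : 𝒢.Edge) : ℝ → ℂ :=
  derivWithin (onEdge f e) (Icc 0 (𝒢.len e))

/-- The second derivative `f_e''` on the edge `e`. -/
noncomputable def ddEdge (f : 𝒢.Point → ℂ) (e : 𝒢.Edge) : ℝ → ℂ :=
  derivWithin (dEdge f e) (Icc 0 (𝒢.len e))

variable (𝒢) in
/-- The Sobolev space `H¹(𝒢)`. -/
def H1 : Set (𝒢.Point → ℂ) :=
  {f | Continuous f ∧ 𝒢.MemL2 (onEdge f) ∧ (∀ e, MemSobolev1 (𝒢.len e) (onEdge f e)) ∧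
    𝒢.MemL2 (dEdge f)}

open Classical in
/-- The slope `f_e'(v) = lim_{x → v} (f_e(x) - f(v)) / |x - v|` of `f` at the vertex `v`
of the edge `e`, in the direction pointing from `v` into the edge. -/
noncomputable def slopeAt (f : 𝒢.Point → ℂ) (e : 𝒢.Edge) (v : V) : ℂ :=
  if 𝒢.src e = v then dEdge f e 0 else - dEdge f e (𝒢.len e)

/-- The Kirchhoff conditions at the vertex `v`. -/
def Kirchhoff (f : 𝒢.Point → ℂ) (v : V) : Prop :=
  ContinuousAt f (𝒢.vertex v) ∧ ∑ᶠ (e : 𝒢.Edge) (_ : v ∈ (e : Sym2 V)), slopeAt f e v = 0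

variable (𝒢) in
/-- The domain of the maximal Kirchhoff Laplacian `𝐇` (which acts edgewise as `f ↦ -f''` in
`L²(𝒢)`): functions `f ∈ L²(𝒢)`, in `H²` on every edge, such that `f'' ∈ L²(𝒢)` and such that
the Kirchhoff conditions hold at all vertices. -/
def domH : Set (𝒢.Point → ℂ) :=
  {f | 𝒢.MemL2 (onEdge f) ∧ (∀ e, MemSobolev2 (𝒢.len e) (onEdge f e)) ∧ 𝒢.MemL2 (ddEdge f) ∧
    ∀ v, Kirchhoff f v}

/-- The end `γ` is nontrivial: `f(γ) ≠ 0` for some `f ∈ H¹(𝒢)`. -/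
def TopEnd.Nontrivial (γ : 𝒢.TopEnd) : Prop :=
  ∃ f ∈ 𝒢.H1, ∃ z : ℂ, HasEndValue f γ z ∧ z ≠ 0

end MetricGraph

/-! Everything rests on one finiteness fact: an edge that meets a set `U` without lying in it must
meet the boundary of `U`, and a compact set meets only finitely many edges
(`finite_edges_crossing`).

Finite volume gives functions. Let `U` be a member of finite volume of a sequence representing the
end. Extend the indicator function of the vertices in `U` by cubics with zero slope at both ends of
every edge. Since all slopes vanish, the Kirchhoff conditions are automatic. The first and second
derivatives live on the finitely many crossing edges, and the function itself is bounded by 1 and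
supported on edges of finite total length (`interpolate_indicator_mem`). Distinct ends have
eventually disjoint neighbourhoods, so a smaller `U` yields the value 1 at one end and 0 at the
others.

Conversely, let `f(γ) = z ≠ 0`. As `|(|f|²)'| ≤ |f|² + |f'|²`, the oscillation of `|f|²` on an edge
is at most its energy there. On a connected set, `|f|²` has an interval as image, covered by the
images of the edges, so its oscillation is at most the total energy of these edges
(`edist_sq_le_tsum_edgeEnergy`). A small neighbourhood of the end avoids all edges except some with
energy below `|z|²/4`, so `|f|²` stays above `|z|²/4` on it; being integrable, it forces finite
volume.

End values also require that exactly one graph end corresponds to `γ`. Existence: walks inside the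
successive `U_n` are concatenated and loop-erased. Uniqueness: two rays are equivalent iff no finite
set of vertices separates their tails (`Ray.equiv_iff_sameEnd`), and each connected open `U_n` joins
its vertices by edges inside `U_n` (`graphIn_reachable`). -/

namespace MetricGraph

variable {V : Type*} {𝒢 : MetricGraph V}

/-! ### Points, edges and vertices -/

variable (𝒢) in
/-- The left endpoint of the interval `[0, |e|]`. -/
def lo (e : 𝒢.Edge) : Icc (0 : ℝ) (𝒢.len e) := ⟨0, left_mem_Icc.2 (𝒢.len_pos e).le⟩

variable (𝒢) in
/-- The right endpoint of the interval `[0, |e|]`. -/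
def hi (e : 𝒢.Edge) : Icc (0 : ℝ) (𝒢.len e) := ⟨𝒢.len e, right_mem_Icc.2 (𝒢.len_pos e).le⟩

theorem lo_lt_hi (e : 𝒢.Edge) : 𝒢.lo e < 𝒢.hi e := 𝒢.len_pos e

theorem lo_le (e : 𝒢.Edge) (t : Icc (0 : ℝ) (𝒢.len e)) : 𝒢.lo e ≤ t := t.2.1

theorem le_hi (e : 𝒢.Edge) (t : Icc (0 : ℝ) (𝒢.len e)) : t ≤ 𝒢.hi e := t.2.2

theorem edgeMap_lo (e : 𝒢.Edge) : 𝒢.edgeMap e (𝒢.lo e) = 𝒢.vertex (𝒢.src e) :=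
  Quotient.sound (Or.inr ⟨𝒢.src e, Or.inl ⟨rfl, rfl⟩, rfl⟩)

theorem edgeMap_hi (e : 𝒢.Edge) : 𝒢.edgeMap e (𝒢.hi e) = 𝒢.vertex (𝒢.tgt e) :=
  Quotient.sound (Or.inr ⟨𝒢.tgt e, Or.inr ⟨rfl, rfl⟩, rfl⟩)

theorem edge_eq_src_tgt (e : 𝒢.Edge) : (e : Sym2 V) = s(𝒢.src e, 𝒢.tgt e) := by
  conv_lhs => rw [← Quot.out_eq (e : Sym2 V)]
  rfl

theorem mem_edge_iff {e : 𝒢.Edge} {v : V} :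
    v ∈ (e : Sym2 V) ↔ 𝒢.src e = v ∨ 𝒢.tgt e = v := by
  rw [edge_eq_src_tgt, Sym2.mem_iff]
  simp only [eq_comm]

theorem pt_of_mem (e : 𝒢.Edge) {t : ℝ} (ht : t ∈ Icc 0 (𝒢.len e)) :
    𝒢.pt e t = 𝒢.edgeMap e ⟨t, ht⟩ := by
  rw [pt, projIcc_of_mem]

theorem exists_edge_of_vertex (v : V) : ∃ e : 𝒢.Edge, v ∈ (e : Sym2 V) := by
  have := 𝒢.infinite
  obtain ⟨w, hw⟩ := 𝒢.connected.preconnected.exists_adj_of_nontrivial v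
  exact ⟨⟨s(v, w), hw⟩, Sym2.mem_mk_left _ _⟩

theorem exists_edgeMap_eq (x : 𝒢.Point) : ∃ e t, 𝒢.edgeMap e t = x := by
  induction x using Quotient.inductionOn with
  | h p =>
    rcases p with v | ⟨e, t⟩
    · obtain ⟨e, he⟩ := 𝒢.exists_edge_of_vertex v
      rcases mem_edge_iff.1 he with rfl | rfl
      · exact ⟨e, 𝒢.lo e, edgeMap_lo e⟩
      · exact ⟨e, 𝒢.hi e, edgeMap_hi e⟩
    · exact ⟨e, t, rfl⟩

theorem finite_edges_at (v : V) : {e : 𝒢.Edge | v ∈ (e : Sym2 V)}.Finite := by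
  have h := (𝒢.locallyFinite v).image (fun w => s(v, w))
  refine Set.Finite.of_finite_image (f := Subtype.val) (h.subset ?_) Subtype.val_injective.injOn
  rintro _ ⟨⟨e, he⟩, hv, rfl⟩
  obtain ⟨w, rfl⟩ := Sym2.mem_iff_exists.1 hv
  exact ⟨w, he, rfl⟩

theorem countable_edge : Countable 𝒢.Edge := by
  have := 𝒢.countable
  have : Countable (Sym2 V) := Quot.mk_surjective.countable
  infer_instance

/-- A function on the vertices and compatible functions on the edges define a function on `𝒢`. -/
def glueFun {α : Type*} (gV : V → α) (g : ∀ e, Icc (0 : ℝ) (𝒢.len e) → α)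
    (h₀ : ∀ e, g e (𝒢.lo e) = gV (𝒢.src e)) (h₁ : ∀ e, g e (𝒢.hi e) = gV (𝒢.tgt e)) :
    𝒢.Point → α :=
  Quotient.lift (fun p : 𝒢.PrePoint => Sum.elim gV (fun q => g q.1 q.2) p) (by
    have key : ∀ (p : 𝒢.PrePoint) v, 𝒢.IsAt p v → Sum.elim gV (fun q => g q.1 q.2) p = gV v := by
      rintro (w | ⟨e, t⟩) v h
      · exact congrArg gV h
      · rcases h with ⟨h, rfl⟩ | ⟨h, rfl⟩
        · rw [← h₀ e]
          exact congrArg (g e) (Subtype.ext h)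
        · rw [← h₁ e]
          exact congrArg (g e) (Subtype.ext h)
    rintro p q (rfl | ⟨v, hp, hq⟩)
    · rfl
    · rw [key p v hp, key q v hq])

/-! ### The topology -/

theorem isOpen_iff_preimage {A : Set 𝒢.Point} :
    IsOpen A ↔ ∀ e, IsOpen (𝒢.edgeMap e ⁻¹' A) := by
  rw [isOpen_iSup_iff]
  exact forall_congr' fun e => isOpen_coinduced

theorem continuous_edgeMap (e : 𝒢.Edge) : Continuous (𝒢.edgeMap e) :=
  ⟨fun _ hA => isOpen_iff_preimage.1 hA e⟩

theorem continuous_iff_edgeMap {X : Type*} [TopologicalSpace X] {f : 𝒢.Point → X} :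
    Continuous f ↔ ∀ e, Continuous (f ∘ 𝒢.edgeMap e) :=
  ⟨fun h e => h.comp (continuous_edgeMap e), fun h =>
    ⟨fun A hA => isOpen_iff_preimage.2 fun e => (h e).isOpen_preimage A hA⟩⟩

theorem isCompact_range_edgeMap (e : 𝒢.Edge) : IsCompact (range (𝒢.edgeMap e)) :=
  isCompact_range (continuous_edgeMap e)

theorem isPreconnected_range_edgeMap (e : 𝒢.Edge) : IsPreconnected (range (𝒢.edgeMap e)) := by
  have : PreconnectedSpace (Icc (0 : ℝ) (𝒢.len e)) :=
    Subtype.preconnectedSpace isPreconnected_Icc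
  exact isPreconnected_range (continuous_edgeMap e)

theorem vertex_src_mem_range (e : 𝒢.Edge) : 𝒢.vertex (𝒢.src e) ∈ range (𝒢.edgeMap e) :=
  ⟨_, edgeMap_lo e⟩

theorem vertex_tgt_mem_range (e : 𝒢.Edge) : 𝒢.vertex (𝒢.tgt e) ∈ range (𝒢.edgeMap e) :=
  ⟨_, edgeMap_hi e⟩

theorem vertex_mem_range {e : 𝒢.Edge} {v : V} (h : v ∈ (e : Sym2 V)) :
    𝒢.vertex v ∈ range (𝒢.edgeMap e) := by
  rcases mem_edge_iff.1 h with rfl | rfl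
  · exact vertex_src_mem_range e
  · exact vertex_tgt_mem_range e

variable (𝒢) in
/-- The open star of a vertex. -/
def star (v : V) : Set 𝒢.Point :=
  {x | glueFun (fun u => u = v)
    (fun e t => (𝒢.src e = v ∧ t ≠ 𝒢.hi e) ∨ (𝒢.tgt e = v ∧ t ≠ 𝒢.lo e))
    (fun e => by simp [(lo_lt_hi e).ne]) (fun e => by simp [(lo_lt_hi e).ne']) x}

theorem edgeMap_mem_star {v : V} {e : 𝒢.Edge} {t} :
    𝒢.edgeMap e t ∈ 𝒢.star v ↔ (𝒢.src e = v ∧ t ≠ 𝒢.hi e) ∨ (𝒢.tgt e = v ∧ t ≠ 𝒢.lo e) :=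
  Iff.rfl

theorem isOpen_star (v : V) : IsOpen (𝒢.star v) := by
  refine isOpen_iff_preimage.2 fun e => ?_
  have : 𝒢.edgeMap e ⁻¹' 𝒢.star v =
      ({_t | 𝒢.src e = v} ∩ {𝒢.hi e}ᶜ) ∪ ({_t | 𝒢.tgt e = v} ∩ {𝒢.lo e}ᶜ) := by
    ext t
    exact edgeMap_mem_star
  rw [this]
  exact (isOpen_const.inter isOpen_compl_singleton).union
    (isOpen_const.inter isOpen_compl_singleton)

/-- The open stars of the vertices cover the graph, and by local finiteness each of them meets only
finitely many edges. -/
theorem finite_edges_meeting_compact {C : Set 𝒢.Point} (hC : IsCompact C) :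
    {e : 𝒢.Edge | (range (𝒢.edgeMap e) ∩ C).Nonempty}.Finite := by
  obtain ⟨T, hT⟩ := hC.elim_finite_subcover 𝒢.star isOpen_star fun x _ => by
    obtain ⟨e, t, rfl⟩ := exists_edgeMap_eq x
    rw [mem_iUnion]
    by_cases h : t = 𝒢.hi e
    · exact ⟨𝒢.tgt e, edgeMap_mem_star.2 (Or.inr ⟨rfl, h ▸ (lo_lt_hi e).ne'⟩)⟩
    · exact ⟨𝒢.src e, edgeMap_mem_star.2 (Or.inl ⟨rfl, h⟩)⟩
  refine (T.finite_toSet.biUnion fun v _ => 𝒢.finite_edges_at v).subset ?_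
  rintro e ⟨_, ⟨t, rfl⟩, hx⟩
  obtain ⟨v, hv, h⟩ := mem_iUnion₂.1 (hT hx)
  exact mem_iUnion₂.2 ⟨v, hv, mem_edge_iff.2 ((edgeMap_mem_star.1 h).imp And.left And.left)⟩

theorem inter_frontier_nonempty_of_isPreconnected {X : Type*} [TopologicalSpace X] {A U : Set X}
    (hA : IsPreconnected A) (h₁ : (A ∩ U).Nonempty) (h₂ : ¬ A ⊆ U) :
    (A ∩ frontier U).Nonempty := by
  by_contra h
  have hd : A ∩ frontier U = ∅ := not_nonempty_iff_eq_empty.1 h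
  have hcov : A ⊆ interior U ∪ (closure U)ᶜ := fun x hx => by
    by_cases hi : x ∈ interior U
    · exact Or.inl hi
    · by_cases hc : x ∈ closure U
      · exact absurd (show x ∈ A ∩ frontier U from ⟨hx, hc, hi⟩) (hd ▸ notMem_empty x)
      · exact Or.inr hc
  rcases isPreconnected_iff_subset_of_disjoint.1 hA _ _ isOpen_interior
    isClosed_closure.isOpen_compl hcov (by
      refine subset_empty_iff.1 fun x hx => hx.2.2 (subset_closure (interior_subset hx.2.1)))
    with h | h
  · exact h₂ (h.trans interior_subset)
  · obtain ⟨x, hx, hU⟩ := h₁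
    exact h hx (subset_closure hU)

/-- Only finitely many edges meet a set with compact boundary without being contained in it. -/
theorem finite_edges_crossing {U : Set 𝒢.Point} (hU : IsCompact (frontier U)) :
    {e : 𝒢.Edge | (range (𝒢.edgeMap e) ∩ U).Nonempty ∧ ¬ range (𝒢.edgeMap e) ⊆ U}.Finite :=
  (finite_edges_meeting_compact hU).subset fun e he =>
    inter_frontier_nonempty_of_isPreconnected (isPreconnected_range_edgeMap e) he.1 he.2

/-- A property that propagates along segments inside `O` is locally constant on `O`. -/
theorem isOpen_of_uIcc_subset {X : Type*} [TopologicalSpace X] [LinearOrder X] [OrderTopology X]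
    {O : Set X} (hO : IsOpen O) {P : X → Prop}
    (hP : ∀ x y, uIcc x y ⊆ O → P x → P y) : IsOpen {x | x ∈ O ∧ P x} := by
  rw [isOpen_iff_mem_nhds]
  rintro x ⟨hx, hPx⟩
  filter_upwards [ordConnectedComponent_mem_nhds.2 (hO.mem_nhds hx)] with y hy
  exact ⟨hy right_mem_uIcc, hP x y hy hPx⟩

/-- A clopen criterion for connected sets in which openness is checked edge by edge; `A` itself need
not be open. -/
theorem subset_or_disjoint_of_edges {U A : Set 𝒢.Point} (hU : IsPreconnected U)
    (h₁ : ∀ e, IsOpen {t | 𝒢.edgeMap e t ∈ U ∧ 𝒢.edgeMap e t ∈ A})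
    (h₂ : ∀ e, IsOpen {t | 𝒢.edgeMap e t ∈ U ∧ 𝒢.edgeMap e t ∉ A}) :
    U ⊆ A ∨ Disjoint U A := by
  rcases isPreconnected_iff_subset_of_disjoint.1 hU {x | x ∈ U ∧ x ∈ A} {x | x ∈ U ∧ x ∉ A}
    (isOpen_iff_preimage.2 h₁) (isOpen_iff_preimage.2 h₂)
    (fun x hx => by by_cases h : x ∈ A <;> simp [hx, h])
    (subset_empty_iff.1 fun x hx => hx.2.2.2 hx.2.1.2) with h | h
  · exact Or.inl fun x hx => (h hx).2
  · exact Or.inr (disjoint_left.2 fun x hx => (h hx).2)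

/-- The graph on the vertices whose edges are those edges of `𝒢` that are contained in `U`. -/
def graphIn (U : Set 𝒢.Point) : SimpleGraph V where
  Adj v w := ∃ e : 𝒢.Edge, (e : Sym2 V) = s(v, w) ∧ range (𝒢.edgeMap e) ⊆ U
  symm := ⟨fun v w ⟨e, h, hU⟩ => ⟨e, h.trans Sym2.eq_swap, hU⟩⟩
  loopless := ⟨fun v ⟨e, h, _⟩ => 𝒢.graph.irrefl (v := v) (by have := e.2; rwa [h] at this)⟩

theorem graphIn_mono {U U' : Set 𝒢.Point} (h : U ⊆ U') : graphIn U ≤ graphIn U' :=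
  fun _ _ ⟨e, he, hU⟩ => ⟨e, he, hU.trans h⟩

theorem graphIn_le (U : Set 𝒢.Point) : graphIn U ≤ 𝒢.graph :=
  fun v w ⟨e, he, _⟩ => by
    have := e.2
    rwa [he] at this

theorem graphIn_adj_mem {U : Set 𝒢.Point} {v w : V} (h : (graphIn U).Adj v w) :
    𝒢.vertex v ∈ U := by
  obtain ⟨e, he, hU⟩ := h
  exact hU (vertex_mem_range (he ▸ Sym2.mem_mk_left v w))

/-- The points of `U` that a segment of their edge inside `U` links to a vertex reachable from `v`
form a relatively clopen subset of `U`, so connectedness makes it all of `U`. -/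
theorem graphIn_reachable {U : Set 𝒢.Point} (hU : IsOpen U) (hc : IsPreconnected U) {v w : V}
    (hv : 𝒢.vertex v ∈ U) (hw : 𝒢.vertex w ∈ U) : (graphIn U).Reachable v w := by
  set K : Set V := {u | (graphIn U).Reachable v u} with hK
  have hKe : ∀ e : 𝒢.Edge, (∀ t, 𝒢.edgeMap e t ∈ U) → (𝒢.src e ∈ K ↔ 𝒢.tgt e ∈ K) := by
    intro e he
    have hadj : (graphIn U).Adj (𝒢.src e) (𝒢.tgt e) :=
      ⟨e, edge_eq_src_tgt e, range_subset_iff.2 he⟩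
    exact ⟨fun h => h.trans hadj.reachable, fun h => h.trans hadj.symm.reachable⟩
  -- The point `t` is linked within `U` to a reachable endpoint of `e`: either backwards to the
  -- source or forwards to the target.
  let P (e : 𝒢.Edge) (t : Icc (0 : ℝ) (𝒢.len e)) : Prop :=
    ((∀ s ≤ t, 𝒢.edgeMap e s ∈ U) ∧ 𝒢.src e ∈ K) ∨ ((∀ s ≥ t, 𝒢.edgeMap e s ∈ U) ∧ 𝒢.tgt e ∈ K)
  have hlo : ∀ e : 𝒢.Edge, ∀ s, s ≤ 𝒢.lo e ↔ s = 𝒢.lo e :=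
    fun e s => ⟨fun h => le_antisymm h (lo_le e s), fun h => h.le⟩
  have hhi : ∀ e : 𝒢.Edge, ∀ s, s ≥ 𝒢.hi e ↔ s = 𝒢.hi e :=
    fun e s => ⟨fun h => le_antisymm (le_hi e s) h, fun h => h.ge⟩
  let A : Set 𝒢.Point := {x | glueFun (fun u => 𝒢.vertex u ∈ U ∧ u ∈ K) P
    (fun e => by
      have := hKe e
      simp only [P, hlo, ge_iff_le, lo_le, forall_eq, edgeMap_lo, forall_const]
      exact propext ⟨fun h => h.elim id fun h => ⟨edgeMap_lo e ▸ h.1 _, (this h.1).2 h.2⟩, Or.inl⟩)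
    (fun e => by
      have := hKe e
      simp only [P, hhi, le_hi, forall_eq, edgeMap_hi, forall_const]
      exact propext ⟨fun h => h.elim (fun h => ⟨edgeMap_hi e ▸ h.1 _, (this h.1).1 h.2⟩) id,
        Or.inr⟩) x}
  have hP : ∀ e x y, uIcc x y ⊆ 𝒢.edgeMap e ⁻¹' U → P e x → P e y := by
    intro e x y hxy h
    refine h.imp (fun h => ⟨fun s hs => ?_, h.2⟩) (fun h => ⟨fun s hs => ?_, h.2⟩)
    · rcases le_total s x with hx | hx
      · exact h.1 s hx
      · exact hxy (mem_uIcc.2 (Or.inl ⟨hx, hs⟩))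
    · rcases le_total x s with hx | hx
      · exact h.1 s hx
      · exact hxy (mem_uIcc.2 (Or.inr ⟨hs, hx⟩))
  have hO := fun e => (continuous_edgeMap e).isOpen_preimage U hU
  rcases subset_or_disjoint_of_edges (A := A) hc
    (fun e => isOpen_of_uIcc_subset (hO e) (hP e))
    (fun e => isOpen_of_uIcc_subset (hO e) (P := fun t => ¬ P e t)
      fun x y h hx hy => hx (hP e y x (uIcc_comm x y ▸ h) hy)) with h | h
  · exact (h hw).2
  · exact absurd (show 𝒢.vertex v ∈ A from ⟨hv, SimpleGraph.Reachable.refl v⟩)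
      (disjoint_left.1 h hv)

/-- A connected open set without vertices is contained in an edge. -/
theorem subset_edge_of_no_vertex {U : Set 𝒢.Point} (hU : IsOpen U) (hc : IsConnected U)
    (h : ∀ v, 𝒢.vertex v ∉ U) : ∃ e, U ⊆ range (𝒢.edgeMap e) := by
  obtain ⟨x, hx⟩ := hc.nonempty
  obtain ⟨e, t, rfl⟩ := exists_edgeMap_eq x
  refine ⟨e, ?_⟩
  -- The interior of the edge `e`. Excluding the endpoints makes the definition compatible with the
  -- gluing, and costs nothing because `U` has no vertices.
  let A : Set 𝒢.Point := {x | glueFun (fun _ => False) (fun e' t => e' = e ∧ t ≠ 𝒢.lo e' ∧ t ≠ 𝒢.hi e')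
    (fun e => by simp) (fun e => by simp) x}
  have hmem : ∀ e' t, 𝒢.edgeMap e' t ∈ U → (𝒢.edgeMap e' t ∈ A ↔ e' = e) := by
    refine fun e' t ht => ⟨And.left, fun he => ⟨he, ?_, ?_⟩⟩
    · intro h'
      change t = 𝒢.lo e' at h'
      rw [h', edgeMap_lo] at ht
      exact h _ ht
    · intro h'
      change t = 𝒢.hi e' at h'
      rw [h', edgeMap_hi] at ht
      exact h _ ht
  have hO := fun e => (continuous_edgeMap e).isOpen_preimage U hU
  rcases subset_or_disjoint_of_edges (A := A) hc.isPreconnected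
    (fun e' => by
      have : {t | 𝒢.edgeMap e' t ∈ U ∧ 𝒢.edgeMap e' t ∈ A} = 𝒢.edgeMap e' ⁻¹' U ∩ {_t | e' = e} := by
        ext t
        exact and_congr_right (hmem e' t)
      rw [this]
      exact (hO e').inter isOpen_const)
    (fun e' => by
      have : {t | 𝒢.edgeMap e' t ∈ U ∧ 𝒢.edgeMap e' t ∉ A} =
          𝒢.edgeMap e' ⁻¹' U ∩ {_t | ¬ e' = e} := by
        ext t
        exact and_congr_right fun ht => not_congr (hmem e' t ht)
      rw [this]
      exact (hO e').inter isOpen_const) with h' | h'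
  · intro y hy
    obtain ⟨e', s, rfl⟩ := exists_edgeMap_eq y
    obtain rfl := (hmem e' s hy).1 (h' hy)
    exact mem_range_self s
  · exact absurd ((hmem e t hx).2 rfl) (disjoint_left.1 h' hx)

/-! ### Sequences representing ends -/

namespace EndSeq

theorem antitone (S : 𝒢.EndSeq) : Antitone S.U := antitone_nat_of_succ_le S.subset

theorem exists_disjoint_of_isCompact (S : 𝒢.EndSeq) {C : Set 𝒢.Point} (hC : IsCompact C) :
    ∃ n, Disjoint (closure (S.U n)) C := by
  obtain ⟨n, hn⟩ := hC.elim_directed_family_closed (fun n => closure (S.U n))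
    (fun n => isClosed_closure) (by rw [S.iInter_closure, inter_empty])
    (directed_of_isDirected_le fun m n h => closure_mono (S.antitone h))
  exact ⟨n, (disjoint_iff_inter_eq_empty.2 hn).symm⟩

/-- Without vertices the set would lie in a single edge, which is compact and hence missed by a
later member. -/
theorem exists_vertex_mem (S : 𝒢.EndSeq) (n : ℕ) : ∃ v, 𝒢.vertex v ∈ S.U n := by
  by_contra! h
  obtain ⟨e, he⟩ := subset_edge_of_no_vertex (S.isOpen n) (S.isConnected n) h
  obtain ⟨m, hm⟩ := S.exists_disjoint_of_isCompact (isCompact_range_edgeMap e)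
  obtain ⟨x, hx⟩ := (S.isConnected (max m n)).nonempty
  exact disjoint_left.1 hm (subset_closure (S.antitone (le_max_left m n) hx))
    (he (S.antitone (le_max_right m n) hx))

theorem exists_vertex_notMem (S : 𝒢.EndSeq) {F : Set V} (hF : F.Finite) :
    ∃ n, ∀ m ≥ n, ∀ v ∈ F, 𝒢.vertex v ∉ S.U m := by
  obtain ⟨n, hn⟩ := S.exists_disjoint_of_isCompact (hF.image 𝒢.vertex).isCompact
  exact ⟨n, fun m hm v hv h =>
    disjoint_left.1 hn (subset_closure (S.antitone hm h)) (mem_image_of_mem _ hv)⟩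

/-- A late member of `S'` misses the compact boundary of `S.U n`, and a connected set missing a
boundary lies on one side of it. -/
theorem subset_or_disjoint (S S' : 𝒢.EndSeq) (n : ℕ) :
    ∃ m, S'.U m ⊆ S.U n ∨ Disjoint (S'.U m) (S.U n) := by
  obtain ⟨m, hm⟩ := S'.exists_disjoint_of_isCompact (S.isCompact_frontier n)
  refine ⟨m, ?_⟩
  by_contra! h
  obtain ⟨x, hx, hx'⟩ := inter_frontier_nonempty_of_isPreconnected (S'.isConnected m).isPreconnected
    (not_disjoint_iff_nonempty_inter.1 h.2) h.1
  exact disjoint_left.1 hm (subset_closure hx) hx'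

/-- If no two members were disjoint, the dichotomy `subset_or_disjoint` would give inclusions both
ways, that is, equivalence. -/
theorem exists_disjoint_of_ne {S S' : 𝒢.EndSeq} {γ γ' : 𝒢.TopEnd} (hS : S.Represents γ)
    (hS' : S'.Represents γ') (h : γ ≠ γ') : ∃ n, Disjoint (S'.U n) (S.U n) := by
  by_contra! hd
  have hd' : ∀ m n, ¬ Disjoint (S'.U m) (S.U n) := fun m n hmn =>
    hd (max m n) (hmn.mono (S'.antitone (le_max_left m n)) (S.antitone (le_max_right m n)))
  refine h (hS.symm.trans ((Quotient.sound fun n => ⟨?_, ?_⟩).trans hS'))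
  · obtain ⟨m, hm⟩ := S.subset_or_disjoint S' n
    exact ⟨m, hm.resolve_right (hd' m n)⟩
  · obtain ⟨m, hm⟩ := S'.subset_or_disjoint S n
    exact ⟨m, hm.resolve_right fun h => hd' n m h.symm⟩

end EndSeq

/-! ### Concatenating infinitely many walks -/

/-- The enumeration of the pairs `(n, i)` with `i ≤ ℓ n` in lexicographic order. -/
def lexEnum (ℓ : ℕ → ℕ) : ℕ → ℕ × ℕ
  | 0 => (0, 0)
  | k + 1 => if (lexEnum ℓ k).2 < ℓ (lexEnum ℓ k).1 then ((lexEnum ℓ k).1, (lexEnum ℓ k).2 + 1)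
      else ((lexEnum ℓ k).1 + 1, 0)

section lexEnum
variable {ℓ : ℕ → ℕ}

theorem lexEnum_succ_of_lt {k : ℕ} (h : (lexEnum ℓ k).2 < ℓ (lexEnum ℓ k).1) :
    lexEnum ℓ (k + 1) = ((lexEnum ℓ k).1, (lexEnum ℓ k).2 + 1) := by
  rw [lexEnum, if_pos h]

theorem lexEnum_succ_of_not_lt {k : ℕ} (h : ¬ (lexEnum ℓ k).2 < ℓ (lexEnum ℓ k).1) :
    lexEnum ℓ (k + 1) = ((lexEnum ℓ k).1 + 1, 0) := by
  rw [lexEnum, if_neg h]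

theorem lexEnum_snd_le (k : ℕ) : (lexEnum ℓ k).2 ≤ ℓ (lexEnum ℓ k).1 := by
  induction k with
  | zero => exact Nat.zero_le _
  | succ k ih =>
    by_cases h : (lexEnum ℓ k).2 < ℓ (lexEnum ℓ k).1
    · rw [lexEnum_succ_of_lt h]
      exact h
    · rw [lexEnum_succ_of_not_lt h]
      exact Nat.zero_le _

theorem lexEnum_strictMono : StrictMono fun k => toLex (lexEnum ℓ k) := by
  refine strictMono_nat_of_lt_succ fun k => ?_
  by_cases h : (lexEnum ℓ k).2 < ℓ (lexEnum ℓ k).1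
  · rw [lexEnum_succ_of_lt h]
    exact Prod.Lex.toLex_lt_toLex.2 (Or.inr ⟨rfl, Nat.lt_succ_self _⟩)
  · rw [lexEnum_succ_of_not_lt h]
    exact Prod.Lex.toLex_lt_toLex.2 (Or.inl (Nat.lt_succ_self _))

theorem lexEnum_injective : Function.Injective (lexEnum ℓ) := fun _ _ h =>
  lexEnum_strictMono.injective (congrArg toLex h)

theorem lexEnum_fst_monotone : Monotone fun k => (lexEnum ℓ k).1 := fun j k h => by
  rcases Prod.Lex.toLex_le_toLex.1 (lexEnum_strictMono.monotone h) with h | h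
  · exact h.le
  · exact h.1.le

theorem exists_lexEnum_eq (n i : ℕ) (hi : i ≤ ℓ n) : ∃ k, lexEnum ℓ k = (n, i) := by
  have row : ∀ n, (∃ k, lexEnum ℓ k = (n, 0)) → ∀ i ≤ ℓ n, ∃ k, lexEnum ℓ k = (n, i) := by
    intro n h0 i
    induction i with
    | zero => exact fun _ => h0
    | succ i ih =>
      intro hi
      obtain ⟨k, hk⟩ := ih (Nat.le_of_succ_le hi)
      refine ⟨k + 1, ?_⟩
      rw [lexEnum_succ_of_lt (by rw [hk]; exact hi), hk]
  refine row n ?_ i hi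
  clear hi
  induction n with
  | zero => exact ⟨0, rfl⟩
  | succ n ih =>
    obtain ⟨k, hk⟩ := row n ih (ℓ n) le_rfl
    refine ⟨k + 1, ?_⟩
    rw [lexEnum_succ_of_not_lt (by rw [hk]; exact lt_irrefl _), hk]

end lexEnum

section concat
variable {H : ℕ → SimpleGraph V} {a b : ℕ → V} (p : ∀ n, (H n).Walk (a n) (b n))

/-- The sequence of vertices that runs through infinitely many walks one after the other. -/
def walkConcat (k : ℕ) : V :=
  (p (lexEnum (fun n => (p n).length) k).1).getVert (lexEnum (fun n => (p n).length) k).2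

/-- The second alternative is the junction of two walks. Nothing is assumed there: in one
application the two vertices coincide, in the other they are joined by an edge of a ray. -/
theorem walkConcat_succ (k : ℕ) :
    (H (lexEnum (fun n => (p n).length) k).1).Adj (walkConcat p k) (walkConcat p (k + 1)) ∨
      ∃ n, walkConcat p k = b n ∧ walkConcat p (k + 1) = a (n + 1) := by
  unfold walkConcat
  have hle := lexEnum_snd_le (ℓ := fun n => (p n).length) k
  by_cases h : (lexEnum (fun n => (p n).length) k).2 < (p (lexEnum (fun n => (p n).length) k).1).length
  · left
    rw [lexEnum_succ_of_lt h]
    exact SimpleGraph.Walk.adj_getVert_succ _ h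
  · refine Or.inr ⟨(lexEnum (fun n => (p n).length) k).1, ?_, ?_⟩
    · exact SimpleGraph.Walk.getVert_of_length_le _ (not_lt.1 h)
    · rw [lexEnum_succ_of_not_lt h]
      exact SimpleGraph.Walk.getVert_zero _

theorem exists_walkConcat_eq_end (n : ℕ) : ∃ k, walkConcat p k = b n ∧
    (lexEnum (fun n => (p n).length) k).1 = n := by
  obtain ⟨k, hk⟩ := exists_lexEnum_eq (ℓ := fun n => (p n).length) n (p n).length le_rfl
  refine ⟨k, ?_, by rw [hk]⟩
  unfold walkConcat
  rw [hk]
  exact SimpleGraph.Walk.getVert_length _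

theorem walkConcat_mem_support (k : ℕ) :
    walkConcat p k ∈ (p (lexEnum (fun n => (p n).length) k).1).support :=
  SimpleGraph.Walk.getVert_mem_support _ _

theorem walkConcat_injective (hp : ∀ n, (p n).IsPath)
    (hd : ∀ m n, m < n → List.Disjoint (p m).support (p n).support) :
    Function.Injective (walkConcat p) := by
  intro j k h
  have hj := walkConcat_mem_support p j
  have hk := walkConcat_mem_support p k
  rw [h] at hj
  rcases lt_trichotomy (lexEnum (fun n => (p n).length) j).1 (lexEnum (fun n => (p n).length) k).1
    with hlt | heq | hlt
  · exact absurd hk (hd _ _ hlt hj)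
  · have h1 := lexEnum_snd_le (ℓ := fun n => (p n).length) j
    have h2 := lexEnum_snd_le (ℓ := fun n => (p n).length) k
    unfold walkConcat at h
    rw [heq] at h h1
    exact lexEnum_injective (Prod.ext heq ((hp _).getVert_injOn h1 h2 h))
  · exact absurd hj (hd _ _ hlt hk)

end concat

/-- A sequence of vertices that visits every vertex only finitely often can be loop-erased. -/
theorem exists_loop_erasure {w : ℕ → V} (hfin : ∀ v, {k | w k = v}.Finite) :
    ∃ t : ℕ → ℕ, StrictMono t ∧ (∀ n, w (t (n + 1)) = w (t n + 1)) ∧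
      ∀ n, ∀ j > t n, w j ≠ w (t n) := by
  have hlast : ∀ k, ∃ L, k ≤ L ∧ w L = w k ∧ ∀ j > L, w j ≠ w k := by
    intro k
    obtain ⟨L, hL⟩ := (hfin (w k)).exists_maximal ⟨k, rfl⟩
    have hmax : ∀ j, w j = w k → j ≤ L := fun j hj => by
      by_contra! hlt
      exact absurd (hL.2 (show j ∈ {i | w i = w k} from hj) hlt.le) (not_le.2 hlt)
    exact ⟨L, hmax k rfl, hL.1, fun j hj h => absurd (hmax j h) (not_le.2 hj)⟩
  choose L hkL hwL hL using hlast
  -- Jump to the last visit of the current vertex, take one step, and repeat.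
  let t : ℕ → ℕ := fun n => Nat.rec (L 0) (fun _ s => L (s + 1)) n
  have ht : ∀ n, t (n + 1) = L (t n + 1) := fun n => rfl
  refine ⟨t, strictMono_nat_of_lt_succ fun n => ?_, fun n => ?_, fun n => ?_⟩
  · rw [ht]
    exact hkL (t n + 1)
  · rw [ht]
    exact hwL _
  · have : ∃ k, t n = L k := by
      cases n with
      | zero => exact ⟨0, rfl⟩
      | succ n => exact ⟨_, ht n⟩
    obtain ⟨k, hk⟩ := this
    rw [hk]
    intro j hj
    rw [hwL]
    exact hL k j hj

/-! ### Equivalence of rays -/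

variable (𝒢) in
/-- The graph obtained by deleting all edges at the vertices in `F`. -/
def avoid (F : Set V) : SimpleGraph V where
  Adj v w := 𝒢.graph.Adj v w ∧ v ∉ F ∧ w ∉ F
  symm := ⟨fun _ _ h => ⟨h.1.symm, h.2.2, h.2.1⟩⟩
  loopless := ⟨fun _ h => 𝒢.graph.irrefl h.1⟩

theorem avoid_walk_notMem {F : Set V} {v w : V} (p : (𝒢.avoid F).Walk v w) (hv : v ∉ F) :
    ∀ u ∈ p.support, u ∉ F := by
  induction p with
  | nil => simpa using hv
  | cons h p ih =>
    intro u hu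
    rcases List.mem_cons.1 (SimpleGraph.Walk.support_cons h p ▸ hu) with rfl | hu
    · exact hv
    · exact ih h.2.2 u hu

namespace Ray

theorem eventually_notMem (R : 𝒢.Ray) {F : Set V} (hF : F.Finite) :
    ∃ N, ∀ n ≥ N, R.vtx n ∉ F := by
  have h := R.injective.tendsto_cofinite.eventually hF.compl_mem_cofinite
  rw [Nat.cofinite_eq_atTop] at h
  exact eventually_atTop.1 h

theorem avoid_reachable_of_le (R : 𝒢.Ray) {F : Set V} {N : ℕ} (hN : ∀ n ≥ N, R.vtx n ∉ F) {n : ℕ}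
    (hn : N ≤ n) : (𝒢.avoid F).Reachable (R.vtx N) (R.vtx n) := by
  induction n, hn using Nat.le_induction with
  | base => exact SimpleGraph.Reachable.refl _
  | succ n hn ih =>
    have : (𝒢.avoid F).Adj (R.vtx n) (R.vtx (n + 1)) :=
      ⟨R.adj n, hN n hn, hN _ (Nat.le_succ_of_le hn)⟩
    exact ih.trans this.reachable

/-- The tails of two rays lie in the same component outside of every finite set of vertices. -/
def SameEnd (R R' : 𝒢.Ray) : Prop :=
  ∀ F : Set V, F.Finite → ∃ N, ∀ m ≥ N, ∀ n ≥ N, (𝒢.avoid F).Reachable (R.vtx m) (R'.vtx n)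

theorem SameEnd.refl (R : 𝒢.Ray) : R.SameEnd R := fun F hF => by
  obtain ⟨N, hN⟩ := R.eventually_notMem hF
  exact ⟨N, fun m hm n hn =>
    (R.avoid_reachable_of_le hN hm).symm.trans (R.avoid_reachable_of_le hN hn)⟩

theorem SameEnd.symm {R R' : 𝒢.Ray} (h : R.SameEnd R') : R'.SameEnd R := fun F hF => by
  obtain ⟨N, hN⟩ := h F hF
  exact ⟨N, fun m hm n hn => (hN n hn m hm).symm⟩

theorem SameEnd.trans {R R' R'' : 𝒢.Ray} (h : R.SameEnd R') (h' : R'.SameEnd R'') :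
    R.SameEnd R'' := fun F hF => by
  obtain ⟨N, hN⟩ := h F hF
  obtain ⟨N', hN'⟩ := h' F hF
  refine ⟨max N N', fun m hm n hn => ?_⟩
  exact (hN m (le_of_max_le_left hm) _ (le_max_left N N')).trans
    (hN' _ (le_max_right N N') n (le_of_max_le_right hn))

theorem SameEnd.of_infinite_inter {R R' : 𝒢.Ray} (h : (range R.vtx ∩ range R'.vtx).Infinite) :
    R.SameEnd R' := fun F hF => by
  obtain ⟨N, hN⟩ := SameEnd.refl R F hF
  obtain ⟨N', hN'⟩ := SameEnd.refl R' F hF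
  obtain ⟨_, ⟨⟨m₀, rfl⟩, n₀, h₀⟩, hv⟩ := (h.sdiff (((finite_Iio N).image R.vtx).union
    ((finite_Iio N').image R'.vtx))).nonempty
  have hm₀ : N ≤ m₀ := by
    by_contra! hlt
    exact hv (Or.inl ⟨m₀, hlt, rfl⟩)
  have hn₀ : N' ≤ n₀ := by
    by_contra! hlt
    exact hv (Or.inr ⟨n₀, hlt, h₀⟩)
  refine ⟨max N N', fun m hm n hn => ?_⟩
  have h1 := hN m (le_of_max_le_left hm) m₀ hm₀
  have h2 := hN' n₀ hn₀ n (le_of_max_le_right hn)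
  rw [h₀] at h2
  exact h1.trans h2

/-- The inductive step for a ray meeting a sequence of rays: leave `R`, avoid the used vertices `F`,
and stop at the vertex of the path that lies furthest along `R'`, so that `R'` can be followed
afterwards without meeting anything used. -/
theorem exists_crossing {R R' : 𝒢.Ray} (h : R.SameEnd R') {F : Set V} (hF : F.Finite) {m : ℕ}
    (hm : ∀ m' > m, R.vtx m' ∉ F) :
    ∃ n, ∃ p : (𝒢.avoid F).Walk (R.vtx (m + 1)) (R'.vtx n), p.IsPath ∧
      ∀ n' > n, R'.vtx n' ∉ F ∪ {v | v ∈ p.support} := by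
  classical
  obtain ⟨N, hN⟩ := h F hF
  obtain ⟨N', hN'⟩ := R'.eventually_notMem hF
  have hr : (𝒢.avoid F).Reachable (R.vtx (m + 1)) (R'.vtx (max N N')) :=
    (R.avoid_reachable_of_le (fun n hn => hm n hn) (le_max_right N (m + 1))).trans
      (hN _ (le_max_left _ _) _ (le_max_left _ _))
  obtain ⟨q, hq⟩ := hr.exists_isPath
  have hfin : {n | N' ≤ n ∧ R'.vtx n ∈ q.support}.Finite :=
    ((q.support.finite_toSet).preimage R'.injective.injOn).subset fun n hn => hn.2
  obtain ⟨n, hn⟩ := hfin.exists_maximal ⟨max N N', le_max_right N N', q.end_mem_support⟩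
  refine ⟨n, q.takeUntil _ hn.1.2, hq.takeUntil _, fun n' hn' h' => ?_⟩
  rcases h' with h' | h'
  · exact hN' n' (hn.1.1.trans hn'.le) h'
  · exact absurd (hn.2 (show n' ∈ {n | N' ≤ n ∧ R'.vtx n ∈ q.support} from
      ⟨hn.1.1.trans hn'.le, q.support_takeUntil_subset_support _ h'⟩) hn'.le) (not_le.2 hn')

/-- If all rays of a sequence belong to the same end, there is a ray that meets all of them, one
after the other, in distinct vertices. -/
theorem exists_ray_meeting {Q : ℕ → 𝒢.Ray} (hQ : ∀ k, (Q k).SameEnd (Q (k + 1))) :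
    ∃ (R : 𝒢.Ray) (b : ℕ → V), Function.Injective b ∧
      ∀ k, b k ∈ range R.vtx ∧ b k ∈ range (Q (k + 1)).vtx := by
  -- The state records the set of used vertices and an index beyond which the current ray `Q k`
  -- avoids them.
  let Inv (k : ℕ) (s : Set V × ℕ) : Prop := s.1.Finite ∧ ∀ m > s.2, (Q k).vtx m ∉ s.1
  have step : ∀ k (s : {s // Inv k s}), ∃ (s' : {s // Inv (k + 1) s})
      (p : (𝒢.avoid s.1.1).Walk ((Q k).vtx (s.1.2 + 1)) ((Q (k + 1)).vtx s'.1.2)),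
      p.IsPath ∧ s'.1.1 = s.1.1 ∪ {v | v ∈ p.support} := by
    rintro k ⟨⟨F, m⟩, hF, hm⟩
    obtain ⟨n, p, hp, hn⟩ := exists_crossing (hQ k) hF hm
    exact ⟨⟨(F ∪ {v | v ∈ p.support}, n), hF.union p.support.finite_toSet, hn⟩, p, hp, rfl⟩
  choose nxt p hp hnxt using step
  let st : ∀ k, {s // Inv k s} := fun k =>
    Nat.rec ⟨(∅, 0), finite_empty, fun _ _ => notMem_empty _⟩ (fun k s => nxt k s) k
  let q : ∀ k, (𝒢.avoid (st k).1.1).Walk ((Q k).vtx ((st k).1.2 + 1))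
    ((Q (k + 1)).vtx (st (k + 1)).1.2) := fun k => p k (st k)
  have hF : ∀ k, (st (k + 1)).1.1 = (st k).1.1 ∪ {v | v ∈ (q k).support} := fun k => hnxt k (st k)
  have hmono : Monotone fun k => (st k).1.1 := monotone_nat_of_le_succ fun k => by
    change (st k).1.1 ⊆ (st (k + 1)).1.1
    rw [hF]
    exact subset_union_left
  have hd : ∀ m n, m < n → List.Disjoint (q m).support (q n).support := by
    intro m n hmn v hv hv'
    have h1 : v ∈ (st (m + 1)).1.1 := by
      rw [hF]
      exact Or.inr hv
    exact avoid_walk_notMem (q n) ((st n).2.2 _ (Nat.lt_succ_self _)) v hv' (hmono hmn h1)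
  have hinj := walkConcat_injective q (fun k => hp k (st k)) hd
  refine ⟨⟨walkConcat q, hinj, fun k => ?_⟩, fun k => (Q (k + 1)).vtx (st (k + 1)).1.2, ?_,
    fun k => ⟨?_, mem_range_self _⟩⟩
  -- At a junction, one edge of `Q (n + 1)` leads from the end of a crossing to the start of the
  -- next.
  · rcases walkConcat_succ q k with h | ⟨n, h1, h2⟩
    · exact h.1
    · rw [h1, h2]
      exact (Q (n + 1)).adj _
  · intro j k hjk
    obtain ⟨j', hj', rfl⟩ := exists_walkConcat_eq_end q j
    obtain ⟨k', hk', rfl⟩ := exists_walkConcat_eq_end q k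
    rw [hinj (hj'.trans (hjk.trans hk'.symm))]
  · obtain ⟨k', hk', -⟩ := exists_walkConcat_eq_end q k
    exact ⟨k', hk'⟩

theorem equiv_iff_sameEnd {R R' : 𝒢.Ray} : R.Equiv R' ↔ R.SameEnd R' := by
  constructor
  · rintro ⟨R₃, h, h'⟩
    exact (SameEnd.of_infinite_inter h).trans (SameEnd.of_infinite_inter h').symm
  · intro h
    -- Alternating the two rays produces a third ray that meets each of them infinitely often.
    let Q : ℕ → 𝒢.Ray := fun k => if Even k then R else R'
    have hQ : ∀ k, (Q k).SameEnd (Q (k + 1)) := by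
      intro k
      by_cases hk : Even k
      · have : ¬ Even (k + 1) := by simpa [Nat.even_add_one] using hk
        simpa only [Q, if_pos hk, if_neg this] using h
      · have : Even (k + 1) := Nat.even_add_one.2 hk
        simpa only [Q, if_neg hk, if_pos this] using h.symm
    obtain ⟨R₃, b, hb, hbQ⟩ := exists_ray_meeting hQ
    refine ⟨R₃, infinite_of_injective_forall_mem (f := fun n => b (2 * n + 1))
      (fun m n hmn => by have := hb hmn; omega) fun n => ⟨?_, (hbQ _).1⟩,
      infinite_of_injective_forall_mem (f := fun n => b (2 * n))
      (fun m n hmn => by have := hb hmn; omega) fun n => ⟨?_, (hbQ _).1⟩⟩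
    · have h1 := (hbQ (2 * n + 1)).2
      have h2 : Even (2 * n + 1 + 1) := ⟨n + 1, by ring⟩
      simpa only [Q, if_pos h2] using h1
    · have h1 := (hbQ (2 * n)).2
      have h2 : ¬ Even (2 * n + 1) := by simp
      simpa only [Q, if_neg h2] using h1

/-- The ray obtained by deleting the first `N` vertices. -/
def tail (R : 𝒢.Ray) (N : ℕ) : 𝒢.Ray where
  vtx n := R.vtx (N + n)
  injective _ _ h := Nat.add_left_cancel (R.injective h)
  adj n := R.adj (N + n)

theorem sameEnd_tail (R : 𝒢.Ray) (N : ℕ) : R.SameEnd (R.tail N) := fun F hF => by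
  obtain ⟨M, hM⟩ := SameEnd.refl R F hF
  exact ⟨M, fun m hm n hn => hM m hm (N + n) (hn.trans (Nat.le_add_left n N))⟩

theorem carrier_subset_iff {R : 𝒢.Ray} {U : Set 𝒢.Point} :
    R.carrier ⊆ U ↔ ∀ n, (graphIn U).Adj (R.vtx n) (R.vtx (n + 1)) := by
  rw [carrier, iUnion_subset_iff]
  refine forall_congr' fun n => ⟨fun h => ⟨_, rfl, h⟩, ?_⟩
  rintro ⟨e, he, h⟩
  obtain rfl : e = ⟨s(R.vtx n, R.vtx (n + 1)), R.adj n⟩ := Subtype.ext he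
  exact h

end Ray

/-! ### The graph end corresponding to a topological end -/

namespace EndSeq

theorem graphIn_walk_mem {U : Set 𝒢.Point} {v w : V} (p : (graphIn U).Walk v w)
    (hv : 𝒢.vertex v ∈ U) : ∀ u ∈ p.support, 𝒢.vertex u ∈ U := by
  induction p with
  | nil => simpa using hv
  | cons h p ih =>
    intro u hu
    rcases List.mem_cons.1 (SimpleGraph.Walk.support_cons h p ▸ hu) with rfl | hu
    · exact hv
    · exact ih (graphIn_adj_mem h.symm) u hu

/-- Some ray runs eventually in every member of a sequence representing an end. -/
theorem exists_ray (S : 𝒢.EndSeq) :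
    ∃ R : 𝒢.Ray, ∀ n, ∃ N, ∀ k ≥ N, (graphIn (S.U n)).Adj (R.vtx k) (R.vtx (k + 1)) := by
  choose v hv using S.exists_vertex_mem
  have hr : ∀ n, (graphIn (S.U n)).Reachable (v n) (v (n + 1)) := fun n =>
    graphIn_reachable (S.isOpen n) (S.isConnected n).isPreconnected (hv n)
      (S.subset n (hv (n + 1)))
  let p : ∀ n, (graphIn (S.U n)).Walk (v n) (v (n + 1)) := fun n => (hr n).some
  let σ := lexEnum fun n => (p n).length
  have htend : ∀ n, ∃ N, ∀ k ≥ N, n ≤ (σ k).1 := fun n => by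
    obtain ⟨N, -, hN⟩ := exists_walkConcat_eq_end p n
    exact ⟨N, fun k hk => hN.symm.le.trans (lexEnum_fst_monotone hk)⟩
  -- Late walks run inside late members of the sequence, which no longer contain `u`.
  have hfin : ∀ u, {k | walkConcat p k = u}.Finite := by
    intro u
    obtain ⟨n, hn⟩ := S.exists_vertex_notMem (finite_singleton u)
    obtain ⟨N, hN⟩ := htend n
    refine (finite_Iio N).subset fun k hk => ?_
    by_contra h
    exact hn _ (hN k (not_lt.1 h)) u rfl
      (hk ▸ graphIn_walk_mem _ (hv _) _ (walkConcat_mem_support p k))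
  obtain ⟨t, ht, hsucc, hlast⟩ := exists_loop_erasure hfin
  have hadj : ∀ k, (graphIn (S.U (σ (t k)).1)).Adj (walkConcat p (t k)) (walkConcat p (t (k + 1))) := by
    intro k
    rw [hsucc]
    rcases walkConcat_succ p (t k) with h | ⟨n, h1, h2⟩
    · exact h
    -- Here consecutive walks share an endpoint, so a junction would repeat a vertex immediately
    -- after its last visit.
    · exact absurd (h2.trans h1.symm) (hlast k _ (Nat.lt_succ_self _))
  refine ⟨⟨fun k => walkConcat p (t k), ?_, fun k => graphIn_le _ (hadj k)⟩, fun n => ?_⟩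
  · intro j k hjk
    rcases lt_trichotomy j k with h | h | h
    · exact absurd hjk.symm (hlast j _ (ht h))
    · exact h
    · exact absurd hjk (hlast k _ (ht h))
  · obtain ⟨N, hN⟩ := htend n
    exact ⟨N, fun k hk => graphIn_mono (S.antitone (hN _ (hk.trans (ht.id_le k)))) (hadj k)⟩

end EndSeq

/-- The graph end containing a given ray. -/
def Ray.toEnd (R : 𝒢.Ray) : 𝒢.GraphEnd := ⟨{R' | R.Equiv R'}, R, rfl⟩

theorem graphIn_reachable_avoid {U : Set 𝒢.Point} {F : Set V} (hF : ∀ v ∈ F, 𝒢.vertex v ∉ U)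
    {v w : V} (h : (graphIn U).Reachable v w) : (𝒢.avoid F).Reachable v w :=
  h.mono fun _ _ h => ⟨graphIn_le U h, fun hv => hF _ hv (graphIn_adj_mem h),
    fun hw => hF _ hw (graphIn_adj_mem h.symm)⟩

/-- A ray of `ω` in `S.U n` and a tail of `R` are joined inside `S.U n`, hence away from any finite
set of vertices that this member misses. Conversely, tails of `R` enter the members of every
equivalent sequence. -/
theorem corresponds_iff {S : 𝒢.EndSeq} {γ : 𝒢.TopEnd} (hS : S.Represents γ) {R : 𝒢.Ray}
    (hR : ∀ n, ∃ N, ∀ k ≥ N, (graphIn (S.U n)).Adj (R.vtx k) (R.vtx (k + 1))) (ω : 𝒢.GraphEnd) :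
    γ.Corresponds ω ↔ ω = R.toEnd := by
  constructor
  · intro h
    obtain ⟨_, R₁, rfl⟩ := ω
    have hsame : R₁.SameEnd R := by
      intro F hF
      obtain ⟨n, hn⟩ := S.exists_vertex_notMem hF
      obtain ⟨R₂, hR₂, hsub⟩ := h S hS n
      obtain ⟨N₁, hN₁⟩ := Ray.equiv_iff_sameEnd.1 hR₂ F hF
      obtain ⟨N₂, hN₂⟩ := hR n
      refine ⟨max N₁ N₂, fun i hi j hj => ?_⟩
      have h2 := graphIn_adj_mem (Ray.carrier_subset_iff.1 hsub N₁)
      have h3 := graphIn_adj_mem (hN₂ j (le_of_max_le_right hj))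
      exact (hN₁ i (le_of_max_le_left hi) N₁ le_rfl).trans
        (graphIn_reachable_avoid (hn n le_rfl)
          (graphIn_reachable (S.isOpen n) (S.isConnected n).isPreconnected h2 h3))
    refine Subtype.ext (Set.ext fun R' => ?_)
    exact Ray.equiv_iff_sameEnd.trans ((⟨hsame.symm.trans, hsame.trans⟩ :
      R₁.SameEnd R' ↔ R.SameEnd R').trans Ray.equiv_iff_sameEnd.symm)
  · rintro rfl S' hS' n
    obtain ⟨j, hj⟩ := (Quotient.exact (hS'.trans hS.symm) n).1
    obtain ⟨N, hN⟩ := hR j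
    refine ⟨R.tail N, Ray.equiv_iff_sameEnd.2 (R.sameEnd_tail N), ?_⟩
    exact Ray.carrier_subset_iff.2 fun k => graphIn_mono hj (hN (N + k) (Nat.le_add_right N k))

end MetricGraph

/-! ### Sobolev functions on an interval -/

section Interval

variable {l : ℝ} {f g g' : ℝ → ℂ}

theorem derivWithin_eqOn_of_hasDerivAt (hl : 0 < l) (hfg : EqOn f g (Icc 0 l))
    (hg : ∀ t, HasDerivAt g (g' t) t) : EqOn (derivWithin f (Icc 0 l)) g' (Icc 0 l) := by
  intro t ht
  rw [derivWithin_congr hfg (hfg ht)]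
  exact (hg t).hasDerivWithinAt.derivWithin (uniqueDiffOn_Icc hl t ht)

theorem memLp_two_of_eqOn_continuous (hfg : EqOn f g (Icc 0 l)) (hg : Continuous g) :
    MemLp f 2 (volume.restrict (Icc 0 l)) := by
  have hae : ∀ᵐ t ∂volume.restrict (Icc 0 l), g t = f t :=
    (ae_restrict_mem measurableSet_Icc).mono fun t ht => (hfg ht).symm
  refine MemLp.ae_eq hae ?_
  obtain ⟨C, hC⟩ := (isCompact_Icc (a := (0 : ℝ)) (b := l)).exists_bound_of_continuousOn
    hg.continuousOn
  exact MemLp.of_bound hg.aestronglyMeasurable C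
    ((ae_restrict_mem measurableSet_Icc).mono fun t ht => hC t ht)

theorem MetricGraph.memSobolev1_of_eqOn (hl : 0 < l) (hfg : EqOn f g (Icc 0 l))
    (hg : ∀ t, HasDerivAt g (g' t) t) (hg' : Continuous g') : MetricGraph.MemSobolev1 l f := by
  refine ⟨?_, memLp_two_of_eqOn_continuous (derivWithin_eqOn_of_hasDerivAt hl hfg hg) hg'⟩
  have hC : ContDiff ℝ 1 g := by
    rw [contDiff_one_iff_deriv, funext fun t => (hg t).deriv]
    exact ⟨fun t => (hg t).differentiableAt, hg'⟩
  refine ContDiffOn.absolutelyContinuousOnInterval ?_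
  rw [uIcc_of_le hl.le]
  exact hC.contDiffOn.congr hfg

theorem eLpNorm_two_sq_le_of_norm_le_one (h : ∀ t ∈ Icc 0 l, ‖f t‖ ≤ 1) :
    eLpNorm f 2 (volume.restrict (Icc 0 l)) ^ 2 ≤ ENNReal.ofReal l := by
  have h1 := eLpNorm_le_of_ae_bound (p := 2) (μ := volume.restrict (Icc 0 l)) (f := f) (C := 1)
    ((ae_restrict_mem measurableSet_Icc).mono h)
  calc eLpNorm f 2 (volume.restrict (Icc 0 l)) ^ 2
      ≤ (ENNReal.ofReal l ^ ((2 : ℝ)⁻¹)) ^ 2 := by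
        gcongr
        simpa using h1
    _ = ENNReal.ofReal l := by
        rw [← ENNReal.rpow_natCast, ← ENNReal.rpow_mul]
        norm_num

theorem eLpNorm_two_sq_eq_zero (h : ∀ t ∈ Icc 0 l, f t = 0) :
    eLpNorm f 2 (volume.restrict (Icc 0 l)) ^ 2 = 0 := by
  have : f =ᵐ[volume.restrict (Icc 0 l)] 0 := (ae_restrict_mem measurableSet_Icc).mono h
  rw [eLpNorm_congr_ae this, eLpNorm_zero]
  norm_num

end Interval

/-! ### A cubic profile joining two values -/

/-- The cubic polynomial with values `a`, `b` and vanishing derivatives at `0` and `l`. -/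
noncomputable def hermite (l : ℝ) (a b : ℂ) (t : ℝ) : ℂ :=
  a + (b - a) * ((3 * (t / l) ^ 2 - 2 * (t / l) ^ 3 : ℝ) : ℂ)

/-- The derivative of `hermite`. -/
noncomputable def hermite' (l : ℝ) (a b : ℂ) (t : ℝ) : ℂ :=
  (b - a) * ((6 * (t / l) / l - 6 * (t / l) ^ 2 / l : ℝ) : ℂ)

/-- The second derivative of `hermite`. -/
noncomputable def hermite'' (l : ℝ) (a b : ℂ) (t : ℝ) : ℂ :=
  (b - a) * ((6 / l / l - 12 * (t / l) / l / l : ℝ) : ℂ)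

theorem hasDerivAt_hermite (l : ℝ) (a b : ℂ) (t : ℝ) :
    HasDerivAt (hermite l a b) (hermite' l a b t) t := by
  have h : HasDerivAt (fun t : ℝ => t / l) (1 / l) t := (hasDerivAt_id t).div_const l
  have h2 := ((h.pow 2).const_mul 3).sub ((h.pow 3).const_mul 2)
  refine ((h2.ofReal_comp.const_mul (b - a)).const_add a).congr_deriv ?_
  unfold hermite'
  push_cast
  ring

theorem hasDerivAt_hermite' (l : ℝ) (a b : ℂ) (t : ℝ) :
    HasDerivAt (hermite' l a b) (hermite'' l a b t) t := by
  have h : HasDerivAt (fun t : ℝ => t / l) (1 / l) t := (hasDerivAt_id t).div_const l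
  have h2 := ((h.const_mul 6).div_const l).sub (((h.pow 2).const_mul 6).div_const l)
  refine (h2.ofReal_comp.const_mul (b - a)).congr_deriv ?_
  unfold hermite''
  push_cast
  ring

theorem continuous_hermite (l : ℝ) (a b : ℂ) : Continuous (hermite l a b) :=
  continuous_iff_continuousAt.2 fun t => (hasDerivAt_hermite l a b t).continuousAt

theorem continuous_hermite' (l : ℝ) (a b : ℂ) : Continuous (hermite' l a b) :=
  continuous_iff_continuousAt.2 fun t => (hasDerivAt_hermite' l a b t).continuousAt

theorem continuous_hermite'' (l : ℝ) (a b : ℂ) : Continuous (hermite'' l a b) := by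
  unfold hermite''
  fun_prop

theorem norm_hermite_le {l : ℝ} (hl : 0 < l) {a b : ℂ} (ha : ‖a‖ ≤ 1) (hb : ‖b‖ ≤ 1) {t : ℝ}
    (ht : t ∈ Icc 0 l) : ‖hermite l a b t‖ ≤ 1 := by
  have hs0 : 0 ≤ t / l := div_nonneg ht.1 hl.le
  have hs1 : t / l ≤ 1 := (div_le_one hl).2 ht.2
  unfold hermite
  set s := t / l
  have hq0 : 0 ≤ 3 * s ^ 2 - 2 * s ^ 3 := by nlinarith [sq_nonneg s]
  have hq1 : 3 * s ^ 2 - 2 * s ^ 3 ≤ 1 := by nlinarith [sq_nonneg (1 - s)]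
  set q := 3 * s ^ 2 - 2 * s ^ 3
  have : a + (b - a) * (q : ℂ) = (((1 - q : ℝ) : ℂ)) * a + (q : ℂ) * b := by
    push_cast
    ring
  rw [this]
  refine (norm_add_le _ _).trans ?_
  rw [norm_mul, norm_mul, Complex.norm_of_nonneg hq0, Complex.norm_of_nonneg (sub_nonneg.2 hq1)]
  nlinarith

namespace MetricGraph

variable {V : Type*} {𝒢 : MetricGraph V}

/-! ### Interpolating a function on the vertices -/

/-- The extension of a function on the vertices to the metric graph by cubic polynomials with
vanishing derivatives at the vertices. -/
noncomputable def interpolate (φ : V → ℂ) : 𝒢.Point → ℂ :=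
  glueFun φ (fun e t => hermite (𝒢.len e) (φ (𝒢.src e)) (φ (𝒢.tgt e)) t)
    (fun e => by simp [lo, hermite])
    (fun e => by
      have := (𝒢.len_pos e).ne'
      simp only [hi, hermite, div_self this]
      push_cast
      ring)

section interpolate
variable (φ : V → ℂ)

theorem continuous_interpolate : Continuous (interpolate φ : 𝒢.Point → ℂ) :=
  continuous_iff_edgeMap.2 fun e =>
    (continuous_hermite (𝒢.len e) (φ (𝒢.src e)) (φ (𝒢.tgt e))).comp continuous_subtype_val

theorem onEdge_interpolate (e : 𝒢.Edge) : EqOn (onEdge (interpolate φ) e)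
    (hermite (𝒢.len e) (φ (𝒢.src e)) (φ (𝒢.tgt e))) (Icc 0 (𝒢.len e)) := by
  intro t ht
  rw [onEdge, pt_of_mem e ht]
  rfl

theorem dEdge_interpolate (e : 𝒢.Edge) : EqOn (dEdge (interpolate φ) e)
    (hermite' (𝒢.len e) (φ (𝒢.src e)) (φ (𝒢.tgt e))) (Icc 0 (𝒢.len e)) :=
  derivWithin_eqOn_of_hasDerivAt (𝒢.len_pos e) (onEdge_interpolate φ e) (hasDerivAt_hermite _ _ _)

theorem ddEdge_interpolate (e : 𝒢.Edge) : EqOn (ddEdge (interpolate φ) e)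
    (hermite'' (𝒢.len e) (φ (𝒢.src e)) (φ (𝒢.tgt e))) (Icc 0 (𝒢.len e)) :=
  derivWithin_eqOn_of_hasDerivAt (𝒢.len_pos e) (dEdge_interpolate φ e) (hasDerivAt_hermite' _ _ _)

theorem memSobolev1_interpolate (e : 𝒢.Edge) :
    MemSobolev1 (𝒢.len e) (onEdge (interpolate φ) e) :=
  memSobolev1_of_eqOn (𝒢.len_pos e) (onEdge_interpolate φ e) (hasDerivAt_hermite _ _ _)
    (continuous_hermite' _ _ _)

theorem memSobolev2_interpolate (e : 𝒢.Edge) :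
    MemSobolev2 (𝒢.len e) (onEdge (interpolate φ) e) :=
  ⟨memSobolev1_interpolate φ e, memSobolev1_of_eqOn (𝒢.len_pos e) (dEdge_interpolate φ e)
    (hasDerivAt_hermite' _ _ _) (continuous_hermite'' _ _ _)⟩

theorem kirchhoff_interpolate (v : V) : Kirchhoff (𝒢 := 𝒢) (interpolate φ) v := by
  refine ⟨(continuous_interpolate φ).continuousAt, ?_⟩
  have h : ∀ e : 𝒢.Edge, slopeAt (interpolate φ) e v = 0 := by
    intro e
    unfold slopeAt
    split_ifs
    · refine (dEdge_interpolate φ e (𝒢.lo e).2).trans ?_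
      simp [hermite', lo]
    · refine neg_eq_zero.2 ((dEdge_interpolate φ e (𝒢.hi e).2).trans ?_)
      simp [hermite', hi, div_self (𝒢.len_pos e).ne']
  simp only [h, finsum_zero]

end interpolate

theorem tsum_lt_top_of_finite_support {ι : Type*} {c : ι → ENNReal} (hc : ∀ i, c i ≠ ⊤)
    (hfin : {i | c i ≠ 0}.Finite) : ∑' i, c i < ⊤ := by
  rw [tsum_eq_sum (s := hfin.toFinset) fun i hi => by simpa using hi]
  exact ENNReal.sum_lt_top.2 fun i _ => (hc i).lt_top

open Classical in
/-- The edges meeting a set of finite volume and compact boundary have finite total length. -/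
theorem tsum_len_lt_top {U : Set 𝒢.Point} (hU : IsCompact (frontier U)) (hvol : 𝒢.vol U < ⊤) :
    ∑' e : 𝒢.Edge, (if (range (𝒢.edgeMap e) ∩ U).Nonempty then ENNReal.ofReal (𝒢.len e) else 0)
      < ⊤ := by
  -- The volume of `U` counts crossing edges only in part; adding the full length of these finitely
  -- many edges compensates.
  let c : 𝒢.Edge → ENNReal := fun e =>
    if (range (𝒢.edgeMap e) ∩ U).Nonempty ∧ ¬ range (𝒢.edgeMap e) ⊆ U
    then ENNReal.ofReal (𝒢.len e) else 0
  have hc : ∑' e, c e < ⊤ := by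
    refine tsum_lt_top_of_finite_support (fun e => ?_) ((finite_edges_crossing hU).subset ?_)
    · dsimp only [c]
      split_ifs <;> simp
    · intro e he
      by_contra h
      exact he (if_neg h)
  refine lt_of_le_of_lt (ENNReal.tsum_le_tsum fun e => ?_) ((ENNReal.tsum_add).trans_lt
    (ENNReal.add_lt_top.2 ⟨hvol, hc⟩))
  by_cases h1 : (range (𝒢.edgeMap e) ∩ U).Nonempty
  · by_cases h2 : range (𝒢.edgeMap e) ⊆ U
    · have : {t : ℝ | t ∈ Icc 0 (𝒢.len e) ∧ 𝒢.pt e t ∈ U} = Icc 0 (𝒢.len e) := by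
        ext t
        exact ⟨And.left, fun ht => ⟨ht, h2 ⟨_, rfl⟩⟩⟩
      rw [if_pos h1, this, Real.volume_Icc, sub_zero]
      exact le_self_add
    · rw [if_pos h1]
      refine le_trans ?_ le_add_self
      exact (if_pos ⟨h1, h2⟩).ge
  · rw [if_neg h1]
    exact zero_le

/-- The set of vertices in a set of finite volume with compact boundary has a smoothed indicator
function in `H¹` and in the domain of the Kirchhoff Laplacian. -/
theorem interpolate_indicator_mem {U : Set 𝒢.Point} (hU : IsCompact (frontier U))
    (hvol : 𝒢.vol U < ⊤) :
    interpolate ({v | 𝒢.vertex v ∈ U}.indicator 1) ∈ 𝒢.H1 ∩ 𝒢.domH := by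
  classical
  set φ : V → ℂ := {v | 𝒢.vertex v ∈ U}.indicator 1 with hφ
  have hφ1 : ∀ v, 𝒢.vertex v ∈ U → φ v = 1 := fun v hv =>
    indicator_of_mem (show v ∈ {v | 𝒢.vertex v ∈ U} from hv) _
  have hφ0 : ∀ v, 𝒢.vertex v ∉ U → φ v = 0 := fun v hv =>
    indicator_of_notMem (show v ∉ {v | 𝒢.vertex v ∈ U} from hv) _
  have hφn : ∀ v, ‖φ v‖ ≤ 1 := fun v => by
    by_cases hv : 𝒢.vertex v ∈ U
    · simp [hφ1 v hv]
    · simp [hφ0 v hv]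
  -- Away from the crossing edges both endpoints carry the same value, so the cubic is constant.
  have hcross : ∀ e : 𝒢.Edge,
      ¬ ((range (𝒢.edgeMap e) ∩ U).Nonempty ∧ ¬ range (𝒢.edgeMap e) ⊆ U) →
      φ (𝒢.tgt e) - φ (𝒢.src e) = 0 := by
    intro e he
    have h1 := vertex_src_mem_range e
    have h2 := vertex_tgt_mem_range e
    by_cases h : (range (𝒢.edgeMap e) ∩ U).Nonempty
    · have hsub : range (𝒢.edgeMap e) ⊆ U := by
        by_contra h'
        exact he ⟨h, h'⟩
      rw [hφ1 _ (hsub h1), hφ1 _ (hsub h2), sub_self]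
    · rw [hφ0 _ fun hv => h ⟨_, h1, hv⟩, hφ0 _ fun hv => h ⟨_, h2, hv⟩, sub_self]
  have hL2 : 𝒢.MemL2 (onEdge (interpolate φ)) := by
    refine ⟨fun e => memLp_two_of_eqOn_continuous (onEdge_interpolate φ e)
      (continuous_hermite _ _ _), lt_of_le_of_lt (ENNReal.tsum_le_tsum fun e => ?_)
      (tsum_len_lt_top hU hvol)⟩
    split_ifs with h
    · refine eLpNorm_two_sq_le_of_norm_le_one fun t ht => ?_
      rw [onEdge_interpolate φ e ht]
      exact norm_hermite_le (𝒢.len_pos e) (hφn _) (hφn _) ht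
    · refine (eLpNorm_two_sq_eq_zero fun t ht => ?_).le
      rw [onEdge_interpolate φ e ht, hermite, hφ0 _ fun hv => h ⟨_, vertex_src_mem_range e, hv⟩,
        hφ0 _ fun hv => h ⟨_, vertex_tgt_mem_range e, hv⟩]
      simp
  have hfin : ∀ F : 𝒢.Edge → ℝ → ℂ, (∀ e, MemLp (F e) 2 (volume.restrict (Icc 0 (𝒢.len e)))) →
      (∀ e, φ (𝒢.tgt e) - φ (𝒢.src e) = 0 → ∀ t ∈ Icc 0 (𝒢.len e), F e t = 0) →
      𝒢.MemL2 F := by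
    refine fun F hF h0 => ⟨hF, tsum_lt_top_of_finite_support
      (fun e => ENNReal.pow_ne_top (hF e).eLpNorm_ne_top)
      ((finite_edges_crossing hU).subset fun e he => ?_)⟩
    by_contra h
    exact he (eLpNorm_two_sq_eq_zero (h0 e (hcross e h)))
  refine ⟨⟨continuous_interpolate φ, hL2, memSobolev1_interpolate φ, hfin _ (fun e =>
    (memSobolev1_interpolate φ e).2) fun e he t ht => ?_⟩,
    hL2, memSobolev2_interpolate φ, hfin _ (fun e => (memSobolev2_interpolate φ e).2.2)
    fun e he t ht => ?_, kirchhoff_interpolate φ⟩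
  · rw [dEdge_interpolate φ e ht, hermite', he, zero_mul]
  · rw [ddEdge_interpolate φ e ht, hermite'', he, zero_mul]

/-! ### Values of the smoothed indicator function at the ends -/

/-- An edge with exactly one endpoint in `U` crosses, so its endpoints lie in `F` and no path
avoiding `F` can use it. -/
theorem avoid_reachable_mem_iff {U : Set 𝒢.Point} {F : Set V}
    (hF : ∀ e : 𝒢.Edge, (range (𝒢.edgeMap e) ∩ U).Nonempty → ¬ range (𝒢.edgeMap e) ⊆ U →
      ∀ v ∈ (e : Sym2 V), v ∈ F) {v w : V} (h : (𝒢.avoid F).Reachable v w) :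
    𝒢.vertex v ∈ U ↔ 𝒢.vertex w ∈ U := by
  have key : ∀ u u', (𝒢.avoid F).Adj u u' → 𝒢.vertex u ∈ U → 𝒢.vertex u' ∈ U := by
    intro u u' h hu
    by_contra hu'
    have h1 := vertex_mem_range (e := ⟨s(u, u'), h.1⟩) (Sym2.mem_mk_left u u')
    have h2 := vertex_mem_range (e := ⟨s(u, u'), h.1⟩) (Sym2.mem_mk_right u u')
    exact h.2.1 (hF _ ⟨_, h1, hu⟩ (fun hsub => hu' (hsub h2)) u (Sym2.mem_mk_left u u'))
  obtain ⟨p⟩ := h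
  induction p with
  | nil => exact Iff.rfl
  | cons h p ih => exact Iff.trans ⟨key _ _ h, key _ _ h.symm⟩ ih

/-- The finite set to be avoided consists of the endpoints of the crossing edges. -/
theorem Ray.SameEnd.eventually_mem_iff {R R' : 𝒢.Ray} (h : R.SameEnd R') {U : Set 𝒢.Point}
    (hU : IsCompact (frontier U)) :
    ∃ N, ∀ m ≥ N, ∀ n ≥ N, (𝒢.vertex (R.vtx m) ∈ U ↔ 𝒢.vertex (R'.vtx n) ∈ U) := by
  have hfin : (⋃ e ∈ {e : 𝒢.Edge | (range (𝒢.edgeMap e) ∩ U).Nonempty ∧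
      ¬ range (𝒢.edgeMap e) ⊆ U}, {v | v ∈ (e : Sym2 V)}).Finite := by
    refine (finite_edges_crossing hU).biUnion fun e _ => ?_
    have : {v | v ∈ (e : Sym2 V)} = {𝒢.src e, 𝒢.tgt e} := by
      ext v
      rw [mem_ofPred_eq, edge_eq_src_tgt, Sym2.mem_iff]
      rfl
    rw [this]
    exact toFinite _
  obtain ⟨N, hN⟩ := h _ hfin
  exact ⟨N, fun m hm n hn => avoid_reachable_mem_iff
    (fun e h1 h2 v hv => mem_iUnion₂.2 ⟨e, ⟨h1, h2⟩, hv⟩) (hN m hm n hn)⟩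

/-- If `S` represents `γ` and the indicator function of `U` is equal to `z` at all vertices of some
member of `S`, the smoothed indicator function of `U` has the value `z` at `γ`. -/
theorem hasEndValue_interpolate {S : 𝒢.EndSeq} {γ : 𝒢.TopEnd} (hS : S.Represents γ)
    {U : Set 𝒢.Point} (hU : IsCompact (frontier U)) {n : ℕ} {z : ℂ}
    (hz : ∀ v, 𝒢.vertex v ∈ S.U n → {v | 𝒢.vertex v ∈ U}.indicator (1 : V → ℂ) v = z) :
    HasEndValue (interpolate ({v | 𝒢.vertex v ∈ U}.indicator 1)) γ z := by
  obtain ⟨R₀, hR₀⟩ := S.exists_ray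
  refine ⟨R₀.toEnd, corresponds_iff hS hR₀, fun R hR => ?_⟩
  obtain ⟨N, hN⟩ := (Ray.equiv_iff_sameEnd.1 hR).eventually_mem_iff hU
  obtain ⟨N', hN'⟩ := hR₀ n
  have h0 := hz _ (graphIn_adj_mem (hN' _ (le_max_right N N')))
  refine tendsto_const_nhds.congr' (eventually_atTop.2 ⟨N, fun k hk => ?_⟩)
  change z = {v | 𝒢.vertex v ∈ U}.indicator (1 : V → ℂ) (R.vtx k)
  rw [← h0]
  have := hN _ (le_max_left N N') k hk
  by_cases h : 𝒢.vertex (R.vtx k) ∈ U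
  · rw [indicator_of_mem (show R.vtx k ∈ {v | 𝒢.vertex v ∈ U} from h),
      indicator_of_mem (show _ ∈ {v | 𝒢.vertex v ∈ U} from this.2 h)]
    rfl
  · rw [indicator_of_notMem (show R.vtx k ∉ {v | 𝒢.vertex v ∈ U} from h),
      indicator_of_notMem (show _ ∉ {v | 𝒢.vertex v ∈ U} from fun h' => h (this.1 h'))]

/-- A finite-volume end can be separated from finitely many other ends. -/
theorem exists_separating_function {N : ℕ} {γ : Fin (N + 1) → 𝒢.TopEnd}
    (hγ : Function.Injective γ) (hvol : (γ 0).HasFiniteVolume) :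
    ∃ f ∈ 𝒢.H1 ∩ 𝒢.domH, HasEndValue f (γ 0) 1 ∧ ∀ j, j ≠ 0 → HasEndValue f (γ j) 0 := by
  obtain ⟨S, hS, m, hm⟩ := hvol
  have hrep : ∀ j, ∃ T : 𝒢.EndSeq, T.Represents (γ j) := fun j => Quotient.exists_rep (γ j)
  choose T hT using hrep
  have hdis : ∀ j, ∃ n, j ≠ 0 → Disjoint ((T j).U n) (S.U n) := by
    intro j
    by_cases hj : j = 0
    · exact ⟨0, fun h => absurd hj h⟩
    · obtain ⟨n, hn⟩ := EndSeq.exists_disjoint_of_ne hS (hT j) (hγ.ne (Ne.symm hj))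
      exact ⟨n, fun _ => hn⟩
  choose n hn using hdis
  -- Late enough for finite volume and for disjointness from a neighbourhood of each other end.
  let M := max m (Finset.univ.sup n)
  have hM : 𝒢.vol (S.U M) < ⊤ := by
    refine lt_of_le_of_lt (ENNReal.tsum_le_tsum fun e => measure_mono ?_) hm
    exact fun t ht => ⟨ht.1, S.antitone (le_max_left _ _) ht.2⟩
  refine ⟨_, interpolate_indicator_mem (S.isCompact_frontier M) hM,
    hasEndValue_interpolate hS (S.isCompact_frontier M) (n := M) fun v hv => ?_, fun j hj =>
    hasEndValue_interpolate (hT j) (S.isCompact_frontier M) (n := n j) fun v hv => ?_⟩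
  · exact indicator_of_mem (show v ∈ {v | 𝒢.vertex v ∈ S.U M} from hv) _
  · refine indicator_of_notMem (fun h => ?_) _
    refine disjoint_left.1 (hn j hj) hv (S.antitone ?_ h)
    exact (Finset.le_sup (Finset.mem_univ j)).trans (le_max_right _ _)

end MetricGraph

/-! ### Oscillation of `|f|²` on an interval -/

section Interval

variable {l : ℝ} {f : ℝ → ℂ}

theorem AbsolutelyContinuousOnInterval.comp_of_dist_le {X Y : Type*} [PseudoMetricSpace X]
    [PseudoMetricSpace Y] {F : ℝ → X} {a b : ℝ} (hF : AbsolutelyContinuousOnInterval F a b)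
    {G : X → Y} (hG : ∀ x y, dist (G x) (G y) ≤ dist x y) :
    AbsolutelyContinuousOnInterval (fun t => G (F t)) a b :=
  squeeze_zero (fun _ => Finset.sum_nonneg fun _ _ => dist_nonneg)
    (fun _ => Finset.sum_le_sum fun _ _ => hG _ _) hF

theorem eLpNorm_two_sq_eq_lintegral {μ : Measure ℝ} (g : ℝ → ℂ) :
    eLpNorm g 2 μ ^ 2 = ∫⁻ t, ‖g t‖ₑ ^ 2 ∂μ := by
  have := eLpNorm_nnreal_pow_eq_lintegral (μ := μ) (f := g) (p := 2) two_ne_zero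
  simpa using this

/-- The oscillation of `|f|²` on an interval is bounded by the squared `H¹`-norm of `f`. -/
theorem MetricGraph.MemSobolev1.edist_sq_le (hl : 0 ≤ l) (hf : MetricGraph.MemSobolev1 l f)
    {x y : ℝ} (hx : x ∈ Icc 0 l) (hy : y ∈ Icc 0 l) :
    edist (‖f x‖ ^ 2) (‖f y‖ ^ 2) ≤ eLpNorm f 2 (volume.restrict (Icc 0 l)) ^ 2 +
      eLpNorm (derivWithin f (Icc 0 l)) 2 (volume.restrict (Icc 0 l)) ^ 2 := by
  have hre : AbsolutelyContinuousOnInterval (fun t => (f t).re) 0 l :=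
    hf.1.comp_of_dist_le fun z w => by
      rw [Real.dist_eq, dist_eq_norm, ← Complex.sub_re]
      exact Complex.abs_re_le_norm _
  have him : AbsolutelyContinuousOnInterval (fun t => (f t).im) 0 l :=
    hf.1.comp_of_dist_le fun z w => by
      rw [Real.dist_eq, dist_eq_norm, ← Complex.sub_im]
      exact Complex.abs_im_le_norm _
  have hac : AbsolutelyContinuousOnInterval (fun t => ‖f t‖ ^ 2) 0 l := by
    have h := (hre.fun_mul hre).fun_add (him.fun_mul him)
    have heq : (fun t => ‖f t‖ ^ 2) =
        fun t => (f t).re * (f t).re + (f t).im * (f t).im := funext fun t => by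
      rw [Complex.sq_norm, Complex.normSq_apply]
    rw [heq]
    exact h
  have hder : ∀ᵐ t ∂volume.restrict (Icc 0 l), ‖deriv (fun t => ‖f t‖ ^ 2) t‖ₑ ≤
      ‖f t‖ₑ ^ 2 + ‖derivWithin f (Icc 0 l) t‖ₑ ^ 2 := by
    rw [ae_restrict_iff' measurableSet_Icc]
    -- The endpoints are discarded because `derivWithin` agrees with `deriv` only in the interior.
    have hne : ∀ a : ℝ, ∀ᵐ t : ℝ, t ≠ a := fun a => by simp [ae_iff]
    filter_upwards [hre.ae_differentiableAt, him.ae_differentiableAt, hne 0, hne l]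
      with t h1 h2 h0 hl' ht
    have htu : t ∈ uIcc 0 l := by rwa [uIcc_of_le hl]
    have d1 := (h1 htu).hasDerivAt
    have d2 := (h2 htu).hasDerivAt
    set a := deriv (fun t => (f t).re) t
    set b := deriv (fun t => (f t).im) t
    have df : HasDerivAt f ((a : ℂ) + b * Complex.I) t := by
      have h := d1.ofReal_comp.add (d2.ofReal_comp.mul_const Complex.I)
      refine h.congr_of_eventuallyEq (Eventually.of_forall fun s => ?_)
      exact (Complex.re_add_im (f s)).symm
    have dn : HasDerivAt (fun t => ‖f t‖ ^ 2) (2 * ((f t).re * a + (f t).im * b)) t := by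
      have h := (d1.mul d1).add (d2.mul d2)
      refine (h.congr_of_eventuallyEq (Eventually.of_forall fun s => ?_)).congr_deriv (by ring)
      simp only [Complex.sq_norm, Complex.normSq_apply, Pi.add_apply, Pi.mul_apply]
    have hnhds : Icc 0 l ∈ 𝓝 t :=
      Icc_mem_nhds (lt_of_le_of_ne ht.1 (Ne.symm h0)) (lt_of_le_of_ne ht.2 hl')
    rw [derivWithin_of_mem_nhds hnhds, df.deriv, dn.deriv]
    have hreal : ‖2 * ((f t).re * a + (f t).im * b)‖ ≤
        ‖f t‖ ^ 2 + ‖(a : ℂ) + b * Complex.I‖ ^ 2 := by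
      rw [Complex.sq_norm, Complex.sq_norm, Complex.normSq_add_mul_I, Complex.normSq_apply,
        Real.norm_eq_abs, abs_le]
      constructor <;>
        nlinarith [sq_nonneg ((f t).re - a), sq_nonneg ((f t).im - b), sq_nonneg ((f t).re + a),
          sq_nonneg ((f t).im + b)]
    simp only [← ofReal_norm]
    rw [← ENNReal.ofReal_pow (norm_nonneg _), ← ENNReal.ofReal_pow (norm_nonneg _),
      ← ENNReal.ofReal_add (by positivity) (by positivity)]
    exact ENNReal.ofReal_le_ofReal hreal
  have hsub : uIcc y x ⊆ uIcc 0 l := by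
    rw [uIcc_of_le hl]
    exact ordConnected_Icc.uIcc_subset hy hx
  have hftc := (hac.mono hsub).integral_deriv_eq_sub
  have hmeas : AEMeasurable (fun t => ‖f t‖ₑ ^ 2) (volume.restrict (Icc 0 l)) := by
    have := hf.1.continuousOn
    rw [uIcc_of_le hl] at this
    exact (this.aestronglyMeasurable measurableSet_Icc).enorm.pow_const 2
  rw [eLpNorm_two_sq_eq_lintegral, eLpNorm_two_sq_eq_lintegral, ← lintegral_add_left' hmeas]
  rw [edist_eq_enorm_sub, ← hftc, ← ofReal_norm,
    intervalIntegral.norm_integral_eq_norm_integral_uIoc, ofReal_norm]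
  refine (enorm_integral_le_lintegral_enorm _).trans ?_
  refine (lintegral_mono_set ?_).trans (lintegral_mono_ae hder)
  exact uIoc_subset_uIcc.trans (hsub.trans (uIcc_of_le hl).subset)

end Interval

/-! ### Nontrivial ends have finite volume -/

namespace MetricGraph

variable {V : Type*} {𝒢 : MetricGraph V}

/-- The squared `H¹`-norm of a function on an edge. -/
noncomputable def edgeEnergy (f : 𝒢.Point → ℂ) (e : 𝒢.Edge) : ENNReal :=
  eLpNorm (onEdge f e) 2 (volume.restrict (Icc 0 (𝒢.len e))) ^ 2 +
    eLpNorm (dEdge f e) 2 (volume.restrict (Icc 0 (𝒢.len e))) ^ 2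

/-- The oscillation of `|f|²` on a connected set is bounded by the energy of `f` on a family of
edges covering the set. -/
theorem edist_sq_le_tsum_edgeEnergy {f : 𝒢.Point → ℂ} (hf : f ∈ 𝒢.H1) {U : Set 𝒢.Point}
    (hU : IsPreconnected U) {T : Set 𝒢.Edge} (hT : U ⊆ ⋃ e ∈ T, range (𝒢.edgeMap e))
    {x y : 𝒢.Point} (hx : x ∈ U) (hy : y ∈ U) :
    edist (‖f x‖ ^ 2) (‖f y‖ ^ 2) ≤ ∑' e : T, edgeEnergy f e := by
  have := 𝒢.countable_edge
  set h : 𝒢.Point → ℝ := fun x => ‖f x‖ ^ 2 with hh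
  have hcont : Continuous h := (hf.1.norm).pow 2
  have hord : (h '' U).OrdConnected := (hU.image h hcont.continuousOn).ordConnected
  -- The segment between the two values lies in the image of `U`, so its length is at most the sum
  -- of the diameters of the edge images; no path from `x` to `y` is needed.
  have hsub : uIcc (h x) (h y) ⊆ ⋃ e : T, h '' range (𝒢.edgeMap e) := by
    refine (hord.uIcc_subset (mem_image_of_mem _ hx) (mem_image_of_mem _ hy)).trans ?_
    rintro _ ⟨z, hz, rfl⟩
    obtain ⟨e, he, hze⟩ := mem_iUnion₂.1 (hT hz)
    exact mem_iUnion.2 ⟨⟨e, he⟩, mem_image_of_mem _ hze⟩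
  calc edist (h x) (h y) = volume (uIcc (h x) (h y)) := by
        rw [Real.volume_interval, edist_comm, edist_dist, Real.dist_eq]
    _ ≤ volume (⋃ e : T, h '' range (𝒢.edgeMap e)) := measure_mono hsub
    _ ≤ ∑' e : T, volume (h '' range (𝒢.edgeMap e)) := measure_iUnion_le _
    _ ≤ ∑' e : T, edgeEnergy f e := ENNReal.tsum_le_tsum fun e => by
        refine (Real.volume_le_diam _).trans (Metric.ediam_le ?_)
        rintro _ ⟨_, ⟨s, rfl⟩, rfl⟩ _ ⟨_, ⟨t, rfl⟩, rfl⟩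
        have := (hf.2.2.1 e).edist_sq_le (𝒢.len_pos e).le s.2 t.2
        simp only [onEdge, pt_of_mem (e : 𝒢.Edge) s.2, pt_of_mem (e : 𝒢.Edge) t.2] at this
        exact this

/-- Markov's inequality on every edge, summed over the edges. -/
theorem vol_lt_top_of_le_norm_sq {f : 𝒢.Point → ℂ} (hf : 𝒢.MemL2 (onEdge f)) {U : Set 𝒢.Point}
    {c : ℝ} (hc : 0 < c) (h : ∀ x ∈ U, c ≤ ‖f x‖ ^ 2) : 𝒢.vol U < ⊤ := by
  have hc0 : ENNReal.ofReal c ≠ 0 := (ENNReal.ofReal_pos.2 hc).ne'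
  have hle : ENNReal.ofReal c * 𝒢.vol U ≤
      ∑' e, eLpNorm (onEdge f e) 2 (volume.restrict (Icc 0 (𝒢.len e))) ^ 2 := by
    rw [vol, ← ENNReal.tsum_mul_left]
    refine ENNReal.tsum_le_tsum fun e => ?_
    rw [eLpNorm_two_sq_eq_lintegral]
    refine le_trans ?_ (mul_meas_ge_le_lintegral₀ ((hf.1 e).1.enorm.pow_const 2)
      (ENNReal.ofReal c))
    refine mul_le_mul_right ?_ _
    rw [Measure.restrict_apply' measurableSet_Icc]
    refine measure_mono fun t ht => ⟨?_, ht.1⟩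
    change ENNReal.ofReal c ≤ ‖f (𝒢.pt e t)‖ₑ ^ 2
    rw [← ofReal_norm, ← ENNReal.ofReal_pow (norm_nonneg _)]
    exact ENNReal.ofReal_le_ofReal (h _ ht.2)
  by_contra htop
  rw [not_lt, top_le_iff] at htop
  rw [htop, ENNReal.mul_top hc0, top_le_iff] at hle
  exact hf.2.ne hle

theorem TopEnd.Nontrivial.hasFiniteVolume {γ : 𝒢.TopEnd} (h : γ.Nontrivial) :
    γ.HasFiniteVolume := by
  obtain ⟨f, hf, z, ⟨ω, hω, hlim⟩, hz⟩ := h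
  obtain ⟨S, hS⟩ : ∃ S : 𝒢.EndSeq, S.Represents γ := Quotient.exists_rep γ
  have hz2 : 0 < ‖z‖ ^ 2 := by positivity
  have hsum : ∑' e, edgeEnergy f e ≠ ⊤ := by
    unfold edgeEnergy
    rw [ENNReal.tsum_add]
    exact (ENNReal.add_lt_top.2 ⟨hf.2.1.2, hf.2.2.2.2⟩).ne
  -- The threshold is `|z|²/4`: some ray vertex in `S.U n` has `|f|² > |z|²/2`, and an oscillation
  -- below `|z|²/4` leaves at least `|z|²/4` everywhere on `S.U n`.
  obtain ⟨E, hE⟩ := ((ENNReal.tendsto_tsum_compl_atTop_zero hsum).eventually_lt_const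
    (ENNReal.ofReal_pos.2 (half_pos (half_pos hz2)))).exists
  obtain ⟨n, hn⟩ := S.exists_disjoint_of_isCompact
    (E.finite_toSet.isCompact_biUnion fun e _ => isCompact_range_edgeMap e)
  have hcover : S.U n ⊆ ⋃ e ∈ {e | e ∉ E}, range (𝒢.edgeMap e) := by
    intro x hx
    obtain ⟨e, t, rfl⟩ := exists_edgeMap_eq x
    refine mem_iUnion₂.2 ⟨e, fun he => ?_, mem_range_self t⟩
    exact disjoint_left.1 hn (subset_closure hx) (mem_iUnion₂.2 ⟨e, he, mem_range_self t⟩)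
  obtain ⟨R, hR, hRU⟩ := (hω ω).2 rfl S hS n
  have hev : ∀ᶠ k in atTop, ‖z‖ ^ 2 / 2 < ‖f (𝒢.vertex (R.vtx k))‖ ^ 2 :=
    ((hlim R hR).norm.pow 2).eventually_const_lt (half_lt_self hz2)
  obtain ⟨k, hk⟩ := hev.exists
  have hkU := graphIn_adj_mem (Ray.carrier_subset_iff.1 hRU k)
  refine ⟨S, hS, n, vol_lt_top_of_le_norm_sq hf.2.1 (half_pos (half_pos hz2)) fun x hx => ?_⟩
  have hosc := (edist_sq_le_tsum_edgeEnergy hf (S.isConnected n).isPreconnected hcover hkU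
    hx).trans_lt hE
  rw [edist_dist, ENNReal.ofReal_lt_ofReal_iff (half_pos (half_pos hz2)), Real.dist_eq,
    abs_lt] at hosc
  linarith [hosc.2]

theorem TopEnd.HasFiniteVolume.nontrivial {γ : 𝒢.TopEnd} (h : γ.HasFiniteVolume) :
    γ.Nontrivial := by
  obtain ⟨f, hf, h1, -⟩ := exists_separating_function (N := 0) (γ := fun _ => γ)
    (fun i j _ => Fin.ext (by omega)) h
  exact ⟨f, hf.1, 1, h1, one_ne_zero⟩

end MetricGraph

theorem theorem3p7 {V : Type*} (𝒢 : MetricGraph V) :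
    (∀ γ : 𝒢.TopEnd, γ.Nontrivial ↔ γ.HasFiniteVolume) ∧
    ∀ (N : ℕ) (γ : Fin (N + 1) → 𝒢.TopEnd), Function.Injective γ → (∀ j, (γ j).Nontrivial) →
      ∃ f ∈ 𝒢.H1 ∩ 𝒢.domH, MetricGraph.HasEndValue f (γ 0) 1 ∧
        ∀ j, j ≠ 0 → MetricGraph.HasEndValue f (γ j) 0 :=
  ⟨fun _ => ⟨MetricGraph.TopEnd.Nontrivial.hasFiniteVolume,
    MetricGraph.TopEnd.HasFiniteVolume.nontrivial⟩,
    fun _ _ hγ h => MetricGraph.exists_separating_function hγ (h 0).hasFiniteVolume⟩
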